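/- Work with functions and distributions that are $1$-periodic in both variables $x=(x_1,x_2)\in\mathbb R^2$. Let $d(x,y)=|x_1-y_1|+|x_2-y_2|^{2/3}$. For a periodic function $g$ put $[g]_\alpha=\sup_{x\ne y}\frac{|g(y)-g(x)|}{d(y,x)^\alpha}$ if $\alpha\in(0,1]$. For a periodic distribution $f$ and $\beta\in(-\frac32,-1]$ put $$[f]_\beta=\inf\{|c|+[g]_{\beta+2}+[h]_{\beta+\frac32}\,:\,f=c+\partial_1^2g+\partial_2h,\ c\in\mathbb R,\ g,h\text{ periodic functions}\}\in[0,\infty].$$ Let $\phi$ be a real Schwartz function on $\mathbb R^2$ with $\phi(-x)=\phi(x)$ and $\int_{\mathbb R^2}\phi\,dx=1$, let $\phi_\ell(x)=\ell^{-5/2}\phi(x_1/\ell,x_2/\ell^{3/2})$ for $\ell>0$. Let $P$ be the $L^2$-orthogonal projection onto the functions of vanishing average in $x_1$, extended by duality to periodic distributions. Let $\xi$ be white noise on the torus $[0,1)^2$ under the expectation $\langle\cdot\rangle$, that is, a random periodic distribution such that $\xi(u)$ is centered Gaussian with variance $\int_{[0,1)^2}u^2\,dx$ for every smooth periodic $u$;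 write $\xi_\ell=\phi_\ell*\xi$. Then for all $1\le p<\infty$ and $0<\varepsilon<\frac14$ there is a constant $C<\infty$, depending only on $p$, $\varepsilon$ and $\phi$, such that $$\Big\langle\sup_{0<\ell\le1}[P\xi_\ell]_{-\frac54-\varepsilon}^p\Big\rangle\le C$$ and, for all $0<\ell_0\le1$, $$\Big\langle\sup_{0<\ell\le\ell_0}[\xi_\ell-\xi]_{-\frac54-\varepsilon}^p\Big\rangle^{1/p}\le C\,\ell_0^{\varepsilon/2}.$$ -/

import Mathlib

open MeasureTheory Set
open scoped ENNReal NNReal ContDiff SchwartzMap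

noncomputable section

namespace WhiteNoiseTorus

/-! ### Periodic functions and test functions -/

/-- `f` is periodic with period `1` in both variables. -/
def IsPeriodic {F : Type*} (f : ℝ × ℝ → F) : Prop :=
  Function.Periodic f (1, 0) ∧ Function.Periodic f (0, 1)

/-- The fundamental cell `[0,1)²`. -/
def unitCell : Set (ℝ × ℝ) := Ico 0 1 ×ˢ Ico 0 1

lemma IsPeriodic.exists_bound {F : Type*} [NormedAddCommGroup F] {f : ℝ × ℝ → F}
    (hf : IsPeriodic f) (hc : Continuous f) : ∃ B : ℝ, ∀ x, ‖f x‖ ≤ B := by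
  obtain ⟨B, hB⟩ := (isCompact_Icc.prod isCompact_Icc :
    IsCompact (Icc (0 : ℝ) 1 ×ˢ Icc (0 : ℝ) 1)).exists_bound_of_continuousOn hc.continuousOn
  refine ⟨B, fun x => ?_⟩
  have h1 := hf.1.sub_zsmul_eq (x := x) ⌊x.1⌋
  have h2 := hf.2.sub_zsmul_eq (x := x - ⌊x.1⌋ • ((1 : ℝ), (0 : ℝ))) ⌊x.2⌋
  rw [← h1, ← h2]
  apply hB
  have e : x - ⌊x.1⌋ • ((1 : ℝ), (0 : ℝ)) - ⌊x.2⌋ • ((0 : ℝ), (1 : ℝ))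
      = (Int.fract x.1, Int.fract x.2) := by
    ext <;> simp [-zsmul_eq_mul]
  rw [e]
  exact ⟨⟨Int.fract_nonneg _, (Int.fract_lt_one _).le⟩,
    ⟨Int.fract_nonneg _, (Int.fract_lt_one _).le⟩⟩

lemma IsPeriodic.fderiv {F : Type*} [NormedAddCommGroup F] [NormedSpace ℝ F] {f : ℝ × ℝ → F}
    (hf : IsPeriodic f) : IsPeriodic (fderiv ℝ f) := by
  constructor
  · intro x
    have h : (fun y => f (y + (1, 0))) = f := funext hf.1
    rw [← fderiv_comp_add_right, h]
  · intro x
    have h : (fun y => f (y + (0, 1))) = f := funext hf.2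
    rw [← fderiv_comp_add_right, h]

/-- The space `C^∞(𝕋²)` of smooth real functions that are `1`-periodic in both variables. -/
def TestFun : Submodule ℝ (ℝ × ℝ → ℝ) where
  carrier := {u | ContDiff ℝ ∞ u ∧ IsPeriodic u}
  zero_mem' := ⟨contDiff_const, fun _ => rfl, fun _ => rfl⟩
  add_mem' := fun hu hv => ⟨hu.1.add hv.1, hu.2.1.add hv.2.1, hu.2.2.add hv.2.2⟩
  smul_mem' := fun c _ hu => ⟨contDiff_const.mul hu.1,
    fun x => congrArg (c * ·) (hu.2.1 x), fun x => congrArg (c * ·) (hu.2.2 x)⟩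

lemma differentiable_testFun (u : TestFun) : Differentiable ℝ (u : ℝ × ℝ → ℝ) :=
  u.2.1.differentiable (by simp)

/-- The derivative of a test function in the fixed direction `e`. -/
def dirDeriv (e : ℝ × ℝ) : TestFun →ₗ[ℝ] TestFun where
  toFun u := ⟨fun x => fderiv ℝ (u : ℝ × ℝ → ℝ) x e,
    (u.2.1.fderiv_right (m := ∞) (by simp)).clm_apply contDiff_const,
    fun x => by simp only [u.2.2.fderiv.1 x], fun x => by simp only [u.2.2.fderiv.2 x]⟩
  map_add' u v := by
    ext x
    simp [fderiv_add (differentiable_testFun u x) (differentiable_testFun v x)]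
  map_smul' c u := by
    ext x
    simp [fderiv_const_smul (differentiable_testFun u x) c]

/-- The partial derivative `∂₁` on test functions. -/
def pd1 : TestFun →ₗ[ℝ] TestFun := dirDeriv (1, 0)

/-- The partial derivative `∂₂` on test functions. -/
def pd2 : TestFun →ₗ[ℝ] TestFun := dirDeriv (0, 1)

/-! ### Periodic distributions -/

/-- The space of periodic distributions: the linear functionals on `C^∞(𝕋²)` that are continuous
for the family of seminorms `sup |∂₁ʲ ∂₂ˡ u|`. -/
def PeriodicDistribution : Submodule ℝ (Module.Dual ℝ TestFun) where
  carrier := {f | ∃ (C : ℝ) (N : ℕ), ∀ (u : TestFun) (B : ℝ),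
    (∀ j l : ℕ, j + l ≤ N → ∀ x : ℝ × ℝ, |(pd1^[j] (pd2^[l] u) : ℝ × ℝ → ℝ) x| ≤ B) →
      |f u| ≤ C * B}
  zero_mem' := ⟨0, 0, fun u B _ => by simp⟩
  add_mem' := by
    rintro f g ⟨C, N, hf⟩ ⟨D, M, hg⟩
    refine ⟨C + D, max N M, fun u B h => ?_⟩
    have h1 := hf u B fun j l hjl => h j l (hjl.trans (le_max_left _ _))
    have h2 := hg u B fun j l hjl => h j l (hjl.trans (le_max_right _ _))
    calc |(f + g) u| ≤ |f u| + |g u| := abs_add_le _ _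
      _ ≤ (C + D) * B := by linarith
  smul_mem' := by
    rintro c f ⟨C, N, hf⟩
    refine ⟨|c| * C, N, fun u B h => ?_⟩
    have h1 := hf u B h
    calc |(c • f) u| = |c| * |f u| := by simp [abs_mul]
      _ ≤ |c| * (C * B) := by gcongr
      _ = |c| * C * B := by ring

/-! ### Averages of translates: convolution and the projection `P` -/

section Averages

variable {Y : Type} [MeasurableSpace Y] {ν : Measure Y} {w : Y → ℝ} {τ : Y → ℝ × ℝ}

lemma integrable_translates (hw : Integrable w ν)
    {F : Type} [NormedAddCommGroup F] [NormedSpace ℝ F] {u : ℝ × ℝ → F}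
    (hc : Continuous u) (hu : IsPeriodic u) (hs : StronglyMeasurable (fun y => τ y))
    (x : ℝ × ℝ) : Integrable (fun y => w y • u (x + τ y)) ν := by
  obtain ⟨B, hB⟩ := hu.exists_bound hc
  refine Integrable.mono' (g := fun y => ‖w y‖ * B) (hw.norm.mul_const B) ?_ ?_
  · exact hw.1.smul (hc.comp_stronglyMeasurable
      (stronglyMeasurable_const.add hs)).aestronglyMeasurable
  · refine Filter.Eventually.of_forall fun y => ?_
    rw [norm_smul (w y)]
    exact mul_le_mul_of_nonneg_left (hB _) (norm_nonneg _)

lemma hasFDerivAt_translates (hw : Integrable w ν) (hτ : Measurable τ)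
    {F : Type} [NormedAddCommGroup F] [NormedSpace ℝ F] [CompleteSpace F] {u : ℝ × ℝ → F}
    (hc : ContDiff ℝ ∞ u) (hu : IsPeriodic u) (x : ℝ × ℝ) :
    HasFDerivAt (fun x => ∫ y, w y • u (x + τ y) ∂ν) (∫ y, w y • fderiv ℝ u (x + τ y) ∂ν) x := by
  have hs := hτ.stronglyMeasurable
  have hc' : Continuous (fderiv ℝ u) := hc.continuous_fderiv (by simp)
  obtain ⟨B, hB⟩ := hu.fderiv.exists_bound hc'
  refine hasFDerivAt_integral_of_dominated_of_fderiv_le (𝕜 := ℝ) (s := univ)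
    (F := fun x y => w y • u (x + τ y)) (F' := fun x y => w y • fderiv ℝ u (x + τ y))
    (bound := fun y => ‖w y‖ * B) Filter.univ_mem ?_ ?_ ?_ ?_ ?_ ?_
  · exact Filter.Eventually.of_forall fun z =>
      (integrable_translates hw hc.continuous hu hs z).1
  · exact integrable_translates hw hc.continuous hu hs x
  · exact (integrable_translates hw hc' hu.fderiv hs x).1
  · refine Filter.Eventually.of_forall fun y z _ => ?_
    rw [norm_smul (w y)]
    exact mul_le_mul_of_nonneg_left (hB _) (norm_nonneg _)
  · exact hw.norm.mul_const B
  · refine Filter.Eventually.of_forall fun y z _ => ?_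
    have hd : HasFDerivAt u (fderiv ℝ u (z + τ y)) (z + τ y) :=
      (hc.differentiable (by simp) _).hasFDerivAt
    exact ((hasFDerivAt_comp_add_right (τ y)).2 hd).const_smul (w y)

lemma isPeriodic_translates {F : Type} [NormedAddCommGroup F] [NormedSpace ℝ F] {u : ℝ × ℝ → F}
    (hu : IsPeriodic u) : IsPeriodic (fun x => ∫ y, w y • u (x + τ y) ∂ν) := by
  constructor
  · intro x
    refine integral_congr_ae (Filter.Eventually.of_forall fun y => ?_)
    simp only [add_right_comm x (1, 0) (τ y), hu.1 (x + τ y)]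
  · intro x
    refine integral_congr_ae (Filter.Eventually.of_forall fun y => ?_)
    simp only [add_right_comm x (0, 1) (τ y), hu.2 (x + τ y)]

lemma contDiff_translates (hw : Integrable w ν) (hτ : Measurable τ) (n : ℕ) :
    ∀ {F : Type} [NormedAddCommGroup F] [NormedSpace ℝ F] [CompleteSpace F] {u : ℝ × ℝ → F},
    ContDiff ℝ ∞ u → IsPeriodic u → ContDiff ℝ n (fun x => ∫ y, w y • u (x + τ y) ∂ν) := by
  induction n with
  | zero =>
    intro F _ _ _ u hc hu
    have h : Differentiable ℝ (fun x => ∫ y, w y • u (x + τ y) ∂ν) :=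
      fun x => (hasFDerivAt_translates hw hτ hc hu x).differentiableAt
    exact contDiff_zero.2 h.continuous
  | succ n ih =>
    intro F _ _ _ u hc hu
    push_cast
    rw [contDiff_succ_iff_fderiv]
    refine ⟨fun x => (hasFDerivAt_translates hw hτ hc hu x).differentiableAt, by simp, ?_⟩
    have h : fderiv ℝ (fun x => ∫ y, w y • u (x + τ y) ∂ν)
        = fun x => ∫ y, w y • fderiv ℝ u (x + τ y) ∂ν :=
      funext fun x => (hasFDerivAt_translates hw hτ hc hu x).fderiv
    rw [h]
    exact ih (hc.fderiv_right (by simp)) hu.fderiv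

end Averages

/-- For integrable `w`, the linear map `u ↦ (x ↦ ∫ w(y) u(x + y) dy)` on test functions. It is the
transpose of the convolution with `w`. -/
def corr (w : ℝ × ℝ → ℝ) (hw : Integrable w) : TestFun →ₗ[ℝ] TestFun where
  toFun u := ⟨fun x => ∫ y, w y • (u : ℝ × ℝ → ℝ) (x + y),
    contDiff_infty.2 fun n => contDiff_translates hw measurable_id n u.2.1 u.2.2,
    isPeriodic_translates (τ := fun y => y) u.2.2⟩
  map_add' u v := by
    ext x
    simp only [Submodule.coe_add, Pi.add_apply, smul_add]
    exact integral_add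
      (integrable_translates hw (τ := fun y => y) u.2.1.continuous u.2.2 stronglyMeasurable_id x)
      (integrable_translates hw (τ := fun y => y) v.2.1.continuous v.2.2 stronglyMeasurable_id x)
  map_smul' c u := by
    ext x
    simp only [Submodule.coe_smul, Pi.smul_apply, RingHom.id_apply]
    rw [← integral_smul]
    simp only [smul_eq_mul, mul_left_comm]

lemma corr_dirDeriv (w : ℝ × ℝ → ℝ) (hw : Integrable w) (e : ℝ × ℝ) (u : TestFun) :
    dirDeriv e (corr w hw u) = corr w hw (dirDeriv e u) := by
  ext x
  change fderiv ℝ (fun x => ∫ y, w y • (u : ℝ × ℝ → ℝ) (x + y)) x e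
    = ∫ y, w y • fderiv ℝ (u : ℝ × ℝ → ℝ) (x + y) e
  rw [(hasFDerivAt_translates (τ := fun y => y) hw measurable_id u.2.1 u.2.2 x).fderiv,
    ContinuousLinearMap.integral_apply (integrable_translates hw (τ := fun y => y)
      (u.2.1.continuous_fderiv (by simp)) u.2.2.fderiv stronglyMeasurable_id x)]
  rfl

lemma abs_corr_le (w : ℝ × ℝ → ℝ) (hw : Integrable w) (u : TestFun) (B : ℝ)
    (h : ∀ x, |(u : ℝ × ℝ → ℝ) x| ≤ B) (x : ℝ × ℝ) :
    |(corr w hw u : ℝ × ℝ → ℝ) x| ≤ (∫ y, ‖w y‖) * B := by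
  rw [← integral_mul_const]
  refine norm_integral_le_of_norm_le (f := fun y => w y • (u : ℝ × ℝ → ℝ) (x + y))
    (hw.norm.mul_const B) (Filter.Eventually.of_forall fun y => ?_)
  rw [norm_smul (w y)]
  exact mul_le_mul_of_nonneg_left (h _) (norm_nonneg _)

/-- The convolution `w * f` of a periodic distribution with an integrable function on `ℝ²`,
`(w * f)(u) = f(x ↦ ∫ w(y) u(x + y) dy)`. -/
def conv (w : ℝ × ℝ → ℝ) (hw : Integrable w) (f : PeriodicDistribution) :
    PeriodicDistribution :=
  ⟨(f : Module.Dual ℝ TestFun).comp (corr w hw), by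
    obtain ⟨f, C, N, hf⟩ := f
    refine ⟨C * ∫ y, ‖w y‖, N, fun u B h => ?_⟩
    rw [mul_assoc]
    refine hf _ _ fun j l hjl => ?_
    have h2 : pd2^[l] (corr w hw u) = corr w hw (pd2^[l] u) :=
      (Function.Semiconj.iterate_right (f := corr w hw)
        (fun v => (corr_dirDeriv w hw (0, 1) v).symm) l u).symm
    have h1 : pd1^[j] (corr w hw (pd2^[l] u)) = corr w hw (pd1^[j] (pd2^[l] u)) :=
      (Function.Semiconj.iterate_right (f := corr w hw)
        (fun v => (corr_dirDeriv w hw (1, 0) v).symm) j _).symm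
    rw [h2, h1]
    exact abs_corr_le w hw _ B (h j l hjl)⟩

/-- The anisotropically rescaled kernel `φ_ℓ(x₁,x₂) = ℓ^{-5/2} φ(x₁/ℓ, x₂/ℓ^{3/2})`. -/
def rescale (φ : 𝓢(ℝ × ℝ, ℝ)) (ℓ : ℝ) (x : ℝ × ℝ) : ℝ :=
  1 / ℓ ^ (5 / 2 : ℝ) * φ (x.1 / ℓ, x.2 / ℓ ^ (3 / 2 : ℝ))

lemma integrable_rescale (φ : 𝓢(ℝ × ℝ, ℝ)) {ℓ : ℝ} (hℓ : 0 < ℓ) : Integrable (rescale φ ℓ) := by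
  have h1 : ℓ⁻¹ ≠ 0 := inv_ne_zero hℓ.ne'
  have h2 : (ℓ ^ (3 / 2 : ℝ))⁻¹ ≠ 0 := inv_ne_zero (Real.rpow_pos_of_pos hℓ _).ne'
  let L : (ℝ × ℝ) ≃L[ℝ] (ℝ × ℝ) :=
    (ContinuousLinearEquiv.unitsEquivAut ℝ (Units.mk0 _ h1)).prodCongr
      (ContinuousLinearEquiv.unitsEquivAut ℝ (Units.mk0 _ h2))
  have h := (SchwartzMap.compCLMOfContinuousLinearEquiv ℝ L φ).integrable (μ := volume)
  exact h.const_mul _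

/-- The mollification `f_ℓ = φ_ℓ * f`. -/
def mollify (φ : 𝓢(ℝ × ℝ, ℝ)) (ℓ : ℝ) (hℓ : 0 < ℓ) (f : PeriodicDistribution) :
    PeriodicDistribution :=
  conv (rescale φ ℓ) (integrable_rescale φ hℓ) f

/-- The average in `x₁` of a test function, as a function of `x` that does not depend on `x₁`. -/
def avg1 : TestFun →ₗ[ℝ] TestFun where
  toFun u := ⟨fun x => ∫ s in Ico (0 : ℝ) 1, (u : ℝ × ℝ → ℝ) (s, x.2), by
    have hw : Integrable (fun _ : ℝ => (1 : ℝ)) (volume.restrict (Ico (0 : ℝ) 1)) :=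
      integrable_const _
    have hτ : Measurable (fun s : ℝ => (s, (0 : ℝ))) := by fun_prop
    have h : ContDiff ℝ ∞ (fun x => ∫ s in Ico (0 : ℝ) 1,
        (1 : ℝ) • (u : ℝ × ℝ → ℝ) (x + (s, 0))) :=
      contDiff_infty.2 fun n => contDiff_translates hw hτ n u.2.1 u.2.2
    have h' : ContDiff ℝ ∞ (fun x : ℝ × ℝ => ((0 : ℝ), x.2)) := by fun_prop
    simpa [Function.comp_def] using h.comp h',
    fun x => by simp, fun x => by
      refine integral_congr_ae (Filter.Eventually.of_forall fun s => ?_)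
      simpa using u.2.2.2 (s, x.2)⟩
  map_add' u v := by
    have hi : ∀ (u : TestFun) (t : ℝ),
        IntegrableOn (fun s => (u : ℝ × ℝ → ℝ) (s, t)) (Ico 0 1) := fun u t =>
      ((u.2.1.continuous.comp (by fun_prop : Continuous fun s : ℝ => (s, t))).continuousOn
        |>.integrableOn_compact isCompact_Icc).mono_set Ico_subset_Icc_self
    ext x
    exact integral_add (hi u x.2) (hi v x.2)
  map_smul' c u := by
    ext x
    exact integral_const_mul c _

/-- The projection `P` onto the functions of vanishing average in `x₁`, on test functions. -/
def projTest : TestFun →ₗ[ℝ] TestFun := LinearMap.id - avg1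

lemma abs_avg1_le (u : TestFun) (B : ℝ) (h : ∀ x, |(u : ℝ × ℝ → ℝ) x| ≤ B) (x : ℝ × ℝ) :
    |(avg1 u : ℝ × ℝ → ℝ) x| ≤ B := by
  have := norm_setIntegral_le_of_norm_le_const (μ := (volume : Measure ℝ)) (s := Ico (0 : ℝ) 1)
    (f := fun s => (u : ℝ × ℝ → ℝ) (s, x.2)) (C := B) (by simp) (fun s _ => h _)
  simp only [measureReal_def, Real.volume_Ico, sub_zero, ENNReal.ofReal_one, ENNReal.toReal_one,
    mul_one] at this
  exact this

lemma hasFDerivAt_avg1 (u : TestFun) (x e : ℝ × ℝ) :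
    (dirDeriv e (avg1 u) : ℝ × ℝ → ℝ) x
      = (avg1 (dirDeriv (0, e.2) u) : ℝ × ℝ → ℝ) x := by
  have hw : Integrable (fun _ : ℝ => (1 : ℝ)) (volume.restrict (Ico (0 : ℝ) 1)) :=
    integrable_const _
  have hτ : Measurable (fun s : ℝ => (s, (0 : ℝ))) := by fun_prop
  let L : (ℝ × ℝ) →L[ℝ] (ℝ × ℝ) := (0 : (ℝ × ℝ) →L[ℝ] ℝ).prod (ContinuousLinearMap.snd ℝ ℝ ℝ)
  have h := (hasFDerivAt_translates hw hτ u.2.1 u.2.2 (L x)).comp x L.hasFDerivAt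
  have hfun : (fun x => ∫ s in Ico (0 : ℝ) 1, (u : ℝ × ℝ → ℝ) (s, x.2))
      = (fun x => ∫ s in Ico (0 : ℝ) 1, (1 : ℝ) • (u : ℝ × ℝ → ℝ) (x + (s, 0))) ∘ L := by
    funext x
    simp [L]
  change fderiv ℝ (fun x => ∫ s in Ico (0 : ℝ) 1, (u : ℝ × ℝ → ℝ) (s, x.2)) x e
    = ∫ s in Ico (0 : ℝ) 1, fderiv ℝ (u : ℝ × ℝ → ℝ) (s, x.2) (0, e.2)
  rw [hfun, h.fderiv, ContinuousLinearMap.comp_apply,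
    ContinuousLinearMap.integral_apply (integrable_translates hw
      (u.2.1.continuous_fderiv (by simp)) u.2.2.fderiv hτ.stronglyMeasurable (L x))]
  simp [L]

lemma pd1_avg1 (u : TestFun) : pd1 (avg1 u) = 0 := by
  rw [← map_zero avg1]
  ext x
  have h := hasFDerivAt_avg1 u x (1, 0)
  have h0 : dirDeriv (0, 0) u = 0 := by
    ext y
    exact map_zero (fderiv ℝ (u : ℝ × ℝ → ℝ) y)
  rw [h0] at h
  exact h

lemma pd2_avg1 (u : TestFun) : pd2 (avg1 u) = avg1 (pd2 u) := by
  ext x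
  exact hasFDerivAt_avg1 u x (0, 1)

/-- The projection `P` on periodic distributions, extended by duality: `(P f)(u) = f(P u)`. -/
def proj (f : PeriodicDistribution) : PeriodicDistribution :=
  ⟨(f : Module.Dual ℝ TestFun).comp projTest, by
    obtain ⟨f, C, N, hf⟩ := f
    refine ⟨C * 2, N, fun u B h => ?_⟩
    rw [mul_assoc]
    refine hf _ _ fun j l hjl x => ?_
    have hB : 0 ≤ B := (abs_nonneg _).trans (h 0 0 (by simp) x)
    have h2 : pd2^[l] (avg1 u) = avg1 (pd2^[l] u) :=
      (Function.Semiconj.iterate_right (f := avg1) (fun v => (pd2_avg1 v).symm) l u).symm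
    have h1 : ∀ v : TestFun, (∀ x, |(v : ℝ × ℝ → ℝ) x| ≤ B) →
        |(pd1^[j] (avg1 v) : ℝ × ℝ → ℝ) x| ≤ B := by
      intro v hv
      cases j with
      | zero => exact abs_avg1_le v B hv x
      | succ j =>
        rw [Function.iterate_succ_apply, pd1_avg1, iterate_map_zero pd1 j]
        simpa using hB
    have h3 : (pd1^[j] (pd2^[l] (projTest u)) : TestFun)
        = pd1^[j] (pd2^[l] u) - pd1^[j] (avg1 (pd2^[l] u)) := by
      rw [← h2, projTest, LinearMap.sub_apply, LinearMap.id_apply, iterate_map_sub,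
        iterate_map_sub]
    rw [h3]
    have h4 := h1 (pd2^[l] u) (h 0 l (by omega))
    have h5 := h j l hjl x
    calc |((pd1^[j] (pd2^[l] u) - pd1^[j] (avg1 (pd2^[l] u)) : TestFun) : ℝ × ℝ → ℝ) x|
        ≤ |(pd1^[j] (pd2^[l] u) : ℝ × ℝ → ℝ) x|
          + |(pd1^[j] (avg1 (pd2^[l] u)) : ℝ × ℝ → ℝ) x| := abs_sub _ _
      _ ≤ 2 * B := by linarith⟩

/-! ### Anisotropic Hölder seminorms -/

/-- The anisotropic distance `d(x,y) = |x₁ - y₁| + |x₂ - y₂|^{2/3}`. -/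
def anisoDist (x y : ℝ × ℝ) : ℝ := |x.1 - y.1| + |x.2 - y.2| ^ (2 / 3 : ℝ)

/-- The Hölder seminorm `[f]_α` of a periodic function, for `α ∈ (0, 3/2)`. In the case `α > 1` a
finite value forces `f` to be differentiable in `x₁`, so that the default value of `deriv` at
points of non-differentiability plays no role. -/
def holderPos (α : ℝ) (f : ℝ × ℝ → ℝ) : ℝ≥0∞ :=
  if α ≤ 1 then
    ⨆ (x : ℝ × ℝ) (y : ℝ × ℝ) (_ : x ≠ y),
      ENNReal.ofReal (|f y - f x| / anisoDist y x ^ α)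
  else
    ⨆ (x : ℝ × ℝ) (y : ℝ × ℝ) (_ : x ≠ y),
      ENNReal.ofReal (|f y - f x - deriv (fun s => f (s, x.2)) x.1 * (y.1 - x.1)|
        / anisoDist y x ^ α)

/-- The seminorm `[f]_β` of a periodic distribution, for `β ∈ (-3/2, 0)`: the infimum of
`|c| + [g]_{β+1} + [h]_{β+3/2}` over the representations `f = c + ∂₁ g + ∂₂ h` if `β > -1`, and of
`|c| + [g]_{β+2} + [h]_{β+3/2}` over the representations `f = c + ∂₁² g + ∂₂ h` if `β ≤ -1`, with
periodic functions `g`, `h` and a constant `c`; it is `∞` if there is none. Functions of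
finite Hölder seminorm are continuous, so that the integrals that test the distributional
identity make sense for every representation that contributes to the infimum. -/
def holderNeg (β : ℝ) (f : PeriodicDistribution) : ℝ≥0∞ :=
  if -1 < β then
    ⨅ (c : ℝ) (g : ℝ × ℝ → ℝ) (h : ℝ × ℝ → ℝ) (_ : IsPeriodic g) (_ : IsPeriodic h)
      (_ : ∀ u : TestFun, f.1 u = c * (∫ x in unitCell, (u : ℝ × ℝ → ℝ) x)
        - (∫ x in unitCell, g x * (pd1 u : ℝ × ℝ → ℝ) x)
        - (∫ x in unitCell, h x * (pd2 u : ℝ × ℝ → ℝ) x)),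
      ENNReal.ofReal |c| + holderPos (β + 1) g + holderPos (β + 3 / 2) h
  else
    ⨅ (c : ℝ) (g : ℝ × ℝ → ℝ) (h : ℝ × ℝ → ℝ) (_ : IsPeriodic g) (_ : IsPeriodic h)
      (_ : ∀ u : TestFun, f.1 u = c * (∫ x in unitCell, (u : ℝ × ℝ → ℝ) x)
        + (∫ x in unitCell, g x * (pd1 (pd1 u) : ℝ × ℝ → ℝ) x)
        - (∫ x in unitCell, h x * (pd2 u : ℝ × ℝ → ℝ) x)),
      ENNReal.ofReal |c| + holderPos (β + 2) g + holderPos (β + 3 / 2) h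

/-! ### White noise and expectation -/

/-- `ξ` is a (real, periodic) white noise: a random periodic distribution such that `ξ(u)` is
centered Gaussian with variance `∫_{[0,1)²} u²` for every test function `u`. Since `ξ` is linear in
`u`, the family `(ξ(u))_u` is then jointly Gaussian with covariance
`⟨ξ(u) ξ(v)⟩ = ∫_{[0,1)²} u v`. -/
def IsWhiteNoise {Ω : Type*} [MeasurableSpace Ω] (μ : Measure Ω)
    (ξ : Ω → PeriodicDistribution) : Prop :=
  ∀ u : TestFun, ProbabilityTheory.HasLaw (fun θ => (ξ θ).1 u)
    (ProbabilityTheory.gaussianReal 0 (∫ x in unitCell, (u : ℝ × ℝ → ℝ) x ^ 2).toNNReal) μ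

/-- The expectation `⟨F⟩ ∈ [0,∞]` of `F ≥ 0`, as an upper integral, so that no measurability of a
supremum over uncountably many random variables is presupposed. -/
def expect {Ω : Type*} [MeasurableSpace Ω] (μ : Measure Ω) (F : Ω → ℝ≥0∞) : ℝ≥0∞ :=
  ⨅ (M : Ω → ℝ≥0∞) (_ : Measurable M) (_ : ∀ᵐ θ ∂μ, F θ ≤ M θ), ∫⁻ θ, M θ ∂μ

/-- The upper integral dominates the Lebesgue integral and agrees with it on (a.e.) measurable
functions. -/
lemma lintegral_le_expect {Ω : Type*} [MeasurableSpace Ω] (μ : Measure Ω) (F : Ω → ℝ≥0∞) :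
    ∫⁻ θ, F θ ∂μ ≤ expect μ F :=
  le_iInf fun _ => le_iInf fun _ => le_iInf fun h => lintegral_mono_ae h

lemma expect_eq_lintegral {Ω : Type*} [MeasurableSpace Ω] (μ : Measure Ω) (F : Ω → ℝ≥0∞)
    (hF : AEMeasurable F μ) : expect μ F = ∫⁻ θ, F θ ∂μ := by
  refine le_antisymm ?_ (lintegral_le_expect μ F)
  rw [lintegral_congr_ae hF.ae_eq_mk]
  exact iInf_le_of_le (hF.mk F) (iInf_le_of_le hF.measurable_mk
    (iInf_le_of_le hF.ae_eq_mk.le le_rfl))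

end WhiteNoiseTorus

end

/-!
Split the Fourier series of a periodic distribution `f` into the anisotropic dyadic shells on which
the larger of `|k₁|` and `|k₂|^(2/3)` is of order `4 ^ j`. A frequency of the shell `j` is divided
by `-(2πk₁)²` when `k₁` dominates and by `2πk₂` otherwise, so that the block `j` of `f` takes the
form `∂₁²gⱼ + ∂₂hⱼ`, and `gⱼ`, `hⱼ` are smaller than the block by the factors `4 ^ (-2 * j)` and
`4 ^ (-3 / 2 * j)`. If the blocks of all sizes obey `sup |block j| ≤ B * 4 ^ (-γ * j)`, and their
derivatives the bounds scaled accordingly, then interpolating the sup and the derivative bounds and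
summing geometric series gives `[f]_β ≲ B` for every `β < γ`.

For white noise the value of a block at a point is Gaussian with standard deviation at most of order
`4 ^ (5 / 4 * j)`. A union bound over a grid with polynomially many points in `4 ^ j`, in a high
moment, controls the blocks on the grid for every `γ < -5/4`; crude bounds on the Fourier
coefficients control their oscillation between the grid points.

Convolution with `φ_ℓ` commutes with derivatives and is bounded on Hölder classes, uniformly in `ℓ`.
For the difference `ξ_ℓ - ξ`, a function of Hölder exponent `α + δ` satisfies
`[g_ℓ - g]_α ≲ ℓ ^ δ [g]_{α + δ}`: treat `d(x, y) ≤ ℓ` and `d(x, y) ≥ ℓ` separately.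
-/

noncomputable section

namespace WhiteNoiseTorus

open Filter Topology
open Real (cos sin)

/-! ### Periodic functions on the unit cell -/

section UnitCell

variable {E : Type*} {G : ℝ × ℝ → E}

lemma IsPeriodic.periodic_fst (hG : IsPeriodic G) (t : ℝ) :
    Function.Periodic (fun s => G (s, t)) 1 := fun s => by simpa using hG.1 (s, t)

lemma IsPeriodic.periodic_snd (hG : IsPeriodic G) (s : ℝ) :
    Function.Periodic (fun t => G (s, t)) 1 := fun t => by simpa using hG.2 (s, t)

lemma IsPeriodic.comp_add (hG : IsPeriodic G) (a : ℝ × ℝ) : IsPeriodic (fun x => G (x + a)) :=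
  ⟨fun x => by simpa only [add_right_comm x] using hG.1 (x + a),
    fun x => by simpa only [add_right_comm x] using hG.2 (x + a)⟩

lemma IsPeriodic.mul {G H : ℝ × ℝ → ℝ} (hG : IsPeriodic G) (hH : IsPeriodic H) :
    IsPeriodic (fun x => G x * H x) :=
  ⟨fun x => by simp only [hG.1 x, hH.1 x], fun x => by simp only [hG.2 x, hH.2 x]⟩

lemma volume_unitCell : volume unitCell = 1 := by
  simp [unitCell, Measure.volume_eq_prod, Measure.prod_prod]

instance isProbabilityMeasure_restrict_unitCell :
    IsProbabilityMeasure ((volume : Measure (ℝ × ℝ)).restrict unitCell) :=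
  ⟨by simp [volume_unitCell]⟩

variable [NormedAddCommGroup E]

lemma integrableOn_Ico_prod (hG : Continuous G) (a b c d : ℝ) :
    IntegrableOn G (Ico a b ×ˢ Ico c d) :=
  (hG.continuousOn.integrableOn_compact (isCompact_Icc.prod isCompact_Icc)).mono_set
    (prod_mono Ico_subset_Icc_self Ico_subset_Icc_self)

lemma integrableOn_unitCell (hG : Continuous G) : IntegrableOn G unitCell :=
  integrableOn_Ico_prod hG 0 1 0 1

variable [NormedSpace ℝ E]

lemma setIntegral_Ico_prod (hG : Continuous G) {a b c d : ℝ} (hab : a ≤ b) (hcd : c ≤ d) :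
    ∫ z in Ico a b ×ˢ Ico c d, G z = ∫ s in a..b, ∫ t in c..d, G (s, t) := by
  rw [Measure.volume_eq_prod, setIntegral_prod _ (integrableOn_Ico_prod hG a b c d)]
  simp only [intervalIntegral.integral_of_le, hab, hcd, integral_Ico_eq_integral_Ioc]

lemma setIntegral_unitCell (hG : Continuous G) :
    ∫ z in unitCell, G z = ∫ s in (0 : ℝ)..1, ∫ t in (0 : ℝ)..1, G (s, t) :=
  setIntegral_Ico_prod hG zero_le_one zero_le_one

lemma IsPeriodic.setIntegral_Ico_prod_eq (hp : IsPeriodic G) (hG : Continuous G) (a b : ℝ) :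
    ∫ z in Ico a (a + 1) ×ˢ Ico b (b + 1), G z = ∫ z in unitCell, G z := by
  rw [setIntegral_Ico_prod hG (by linarith) (by linarith), setIntegral_unitCell hG]
  have inner (s : ℝ) : ∫ t in b..b + 1, G (s, t) = ∫ t in (0 : ℝ)..1, G (s, t) := by
    simpa only [zero_add] using (hp.periodic_snd s).intervalIntegral_add_eq b 0
  have outer : Function.Periodic (fun s => ∫ t in (0 : ℝ)..1, G (s, t)) 1 := fun s =>
    intervalIntegral.integral_congr fun t _ => hp.periodic_fst t s
  simpa only [inner, zero_add] using outer.intervalIntegral_add_eq a 0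

lemma IsPeriodic.setIntegral_add (hp : IsPeriodic G) (hG : Continuous G) (a : ℝ × ℝ) :
    ∫ x in unitCell, G (x + a) = ∫ x in unitCell, G x := by
  rw [← hp.setIntegral_Ico_prod_eq hG a.1 a.2,
    setIntegral_Ico_prod hG (by linarith) (by linarith),
    setIntegral_unitCell (G := fun x => G (x + a)) (hG.comp (continuous_add_const a))]
  have inner (s : ℝ) :
      ∫ t in (0 : ℝ)..1, G ((s, t) + (a.1, a.2)) = ∫ t in a.2..a.2 + 1, G (s + a.1, t) := by
    simpa only [zero_add, add_comm (1 : ℝ), Prod.mk_add_mk] using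
      intervalIntegral.integral_comp_add_right (a := 0) (b := 1) (fun t => G (s + a.1, t)) a.2
  simpa only [inner, zero_add, add_comm (1 : ℝ)] using
    intervalIntegral.integral_comp_add_right (a := 0) (b := 1)
      (fun s => ∫ t in a.2..a.2 + 1, G (s, t)) a.1

end UnitCell

lemma continuous_testFun (u : TestFun) : Continuous u.1 := u.2.1.continuous

lemma isPeriodic_testFun (u : TestFun) : IsPeriodic u.1 := u.2.2

lemma exists_abs_testFun_add_sub_le (u : TestFun) :
    ∃ L : ℝ, 0 ≤ L ∧ ∀ x y, |u.1 (x + y) - u.1 x| ≤ L * ‖y‖ := by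
  obtain ⟨L, hL⟩ := (isPeriodic_testFun u).fderiv.exists_bound
    (u.2.1.continuous_fderiv (by simp))
  refine ⟨L, (norm_nonneg _).trans (hL 0), fun x y => ?_⟩
  simpa using convex_univ.norm_image_sub_le_of_norm_fderiv_le (𝕜 := ℝ) (f := u.1)
    (fun z _ => differentiable_testFun u z) (fun z _ => hL z) (mem_univ x) (mem_univ (x + y))

/-! ### Trigonometric test functions -/

section Trig

variable (k l : ℤ × ℤ) (φ ψ : ℝ) (x y : ℝ × ℝ)

/-- The phase `2π k·x` of the plane wave with frequency `k`. -/
def phase (k : ℤ × ℤ) (x : ℝ × ℝ) : ℝ := 2 * Real.pi * (k.1 * x.1 + k.2 * x.2)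

lemma contDiff_phase : ContDiff ℝ ∞ (phase k) := by
  unfold phase
  fun_prop

lemma phase_add : phase k (x + y) = phase k x + phase k y := by
  simp only [phase, Prod.fst_add, Prod.snd_add]
  ring

lemma phase_add_left : phase (k + l) x = phase k x + phase l x := by
  simp only [phase, Prod.fst_add, Prod.snd_add, Int.cast_add]
  ring

lemma phase_neg_left : phase (-k) x = -phase k x := by
  simp only [phase, Prod.fst_neg, Prod.snd_neg, Int.cast_neg]
  ring

lemma phase_sub_left : phase (k - l) x = phase k x - phase l x := by
  rw [sub_eq_add_neg, phase_add_left, phase_neg_left, sub_eq_add_neg]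

lemma phase_zero_left : phase 0 x = 0 := by simp [phase]

lemma isPeriodic_cos_phase : IsPeriodic (fun x => cos (phase k x + φ)) := by
  have h1 : phase k (1, 0) = k.1 * (2 * Real.pi) := by simp [phase, mul_comm]
  have h2 : phase k (0, 1) = k.2 * (2 * Real.pi) := by simp [phase, mul_comm]
  constructor <;> intro x <;>
    simp only [phase_add, h1, h2, add_right_comm _ _ φ, Real.cos_add_int_mul_two_pi]

/-- The trigonometric test function `cos (2π k·x + φ)`. A real phase `φ` takes the place of
complex exponentials. -/
def trig (k : ℤ × ℤ) (φ : ℝ) : TestFun :=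
  ⟨fun x => cos (phase k x + φ),
    Real.contDiff_cos.comp ((contDiff_phase k).add contDiff_const), isPeriodic_cos_phase k φ⟩

lemma trig_apply : (trig k φ).1 x = cos (phase k x + φ) := rfl

lemma continuous_cos_phase : Continuous (fun x => cos (phase k x + φ)) :=
  continuous_testFun (trig k φ)

lemma trig_eq_cos_smul_add_sin_smul :
    trig k φ = cos φ • trig k 0 + sin φ • trig k (Real.pi / 2) := by
  ext x
  simp only [Submodule.coe_add, Submodule.coe_smul, Pi.add_apply, Pi.smul_apply, trig_apply,
    smul_eq_mul, add_zero, Real.cos_add_pi_div_two, Real.cos_add (phase k x) φ]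
  ring

lemma trig_neg : trig (-k) φ = trig k (-φ) := by
  ext x
  rw [trig_apply, trig_apply, phase_neg_left, ← Real.cos_neg, neg_add, neg_neg]

lemma trig_add_pi : trig k (φ + Real.pi) = -trig k φ := by
  ext x
  simp only [trig_apply, ← add_assoc, Real.cos_add_pi]
  rfl

lemma dirDeriv_trig (e : ℝ × ℝ) :
    dirDeriv e (trig k φ) = phase k e • trig k (φ + Real.pi / 2) := by
  ext x
  change fderiv ℝ (fun x => cos (phase k x + φ)) x e = _
  have hphase : HasFDerivAt (phase k)
      ((2 * Real.pi) • ((k.1 : ℝ) • ContinuousLinearMap.fst ℝ ℝ ℝ +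
        (k.2 : ℝ) • ContinuousLinearMap.snd ℝ ℝ ℝ)) x :=
    ((hasFDerivAt_fst.const_mul (k.1 : ℝ)).add (hasFDerivAt_snd.const_mul (k.2 : ℝ))).const_mul _
  rw [(hphase.add_const φ).cos.fderiv, Submodule.coe_smul, Pi.smul_apply, trig_apply, ← add_assoc,
    Real.cos_add_pi_div_two]
  simp [phase]
  ring

lemma pd1_trig : pd1 (trig k φ) = (2 * Real.pi * k.1) • trig k (φ + Real.pi / 2) := by
  simp [pd1, dirDeriv_trig, phase]

lemma pd2_trig : pd2 (trig k φ) = (2 * Real.pi * k.2) • trig k (φ + Real.pi / 2) := by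
  simp [pd2, dirDeriv_trig, phase]

lemma pd1_pd1_trig : pd1 (pd1 (trig k φ)) = (-(2 * Real.pi * k.1) ^ 2) • trig k φ := by
  rw [pd1_trig, map_smul, pd1_trig, smul_smul, add_assoc, add_halves, trig_add_pi, smul_neg,
    ← neg_smul, sq]

lemma exists_phase_eq_pi {k : ℤ × ℤ} (hk : k ≠ 0) : ∃ a, phase k a = Real.pi := by
  by_cases h1 : k.1 = 0
  · have h2 : (k.2 : ℝ) ≠ 0 := fun h => hk (Prod.ext h1 (by exact_mod_cast h))
    exact ⟨(0, 1 / (2 * k.2)), by simp only [phase, h1]; field_simp; simp⟩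
  · have h1 : (k.1 : ℝ) ≠ 0 := by exact_mod_cast h1
    exact ⟨(1 / (2 * k.1), 0), by simp only [phase]; field_simp; simp⟩

lemma setIntegral_cos_phase :
    ∫ x in unitCell, cos (phase k x + φ) = if k = 0 then cos φ else 0 := by
  split_ifs with hk
  · simp [hk, phase_zero_left, measureReal_def]
  · obtain ⟨a, ha⟩ := exists_phase_eq_pi hk
    -- A translation by `a` changes the sign of the integrand.
    have h := (isPeriodic_cos_phase k φ).setIntegral_add (continuous_cos_phase k φ) a
    simp only [phase_add, ha, add_right_comm _ _ φ, Real.cos_add_pi, integral_neg] at h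
    linarith

lemma cos_phase_mul_cos_phase : cos (phase k x + φ) * cos (phase l x + ψ)
    = 1 / 2 * cos (phase (k - l) x + (φ - ψ)) + 1 / 2 * cos (phase (k + l) x + (φ + ψ)) := by
  rw [phase_add_left, phase_sub_left, sub_add_sub_comm, add_add_add_comm (phase k x), Real.cos_sub,
    Real.cos_add (phase k x + φ)]
  ring

lemma setIntegral_cos_phase_mul_cos_phase :
    ∫ x in unitCell, cos (phase k x + φ) * cos (phase l x + ψ)
      = (if k = l then cos (φ - ψ) / 2 else 0) + (if k = -l then cos (φ + ψ) / 2 else 0) := by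
  simp only [cos_phase_mul_cos_phase]
  rw [integral_add ((integrableOn_unitCell (continuous_cos_phase _ _)).const_mul _)
    ((integrableOn_unitCell (continuous_cos_phase _ _)).const_mul _), integral_const_mul,
    integral_const_mul, setIntegral_cos_phase, setIntegral_cos_phase]
  simp only [sub_eq_zero, add_eq_zero_iff_eq_neg]
  split_ifs <;> ring

end Trig

/-! ### Approximate identities and density of trigonometric polynomials -/

section ApproximateIdentity

lemma iterate_pd_corr (w : ℝ × ℝ → ℝ) (hw : Integrable w) (j l : ℕ) (u : TestFun) :
    pd1^[j] (pd2^[l] (corr w hw u)) = corr w hw (pd1^[j] (pd2^[l] u)) := by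
  have commute (e : ℝ × ℝ) : Function.Commute (dirDeriv e) (corr w hw) := corr_dirDeriv w hw e
  exact (((commute (1, 0)).iterate_left j).comp_left ((commute (0, 1)).iterate_left l)) u

lemma abs_corr_sub_le {w : ℝ × ℝ → ℝ} (hw : Integrable w) (hw_nonneg : 0 ≤ w)
    (hw_int : ∫ y, w y = 1) (hw_moment : Integrable fun y => w y * ‖y‖) {u : TestFun} {L : ℝ}
    (hL : ∀ x y, |u.1 (x + y) - u.1 x| ≤ L * ‖y‖) (x : ℝ × ℝ) :
    |(corr w hw u - u).1 x| ≤ (∫ y, w y * ‖y‖) * L := by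
  have hint := integrable_translates hw (τ := fun y => y) (continuous_testFun u)
    (isPeriodic_testFun u) stronglyMeasurable_id x
  have hsub : (corr w hw u - u).1 x = ∫ y, w y * (u.1 (x + y) - u.1 x) := by
    simp only [smul_eq_mul] at hint
    simp only [mul_sub]
    rw [integral_sub hint (hw.mul_const _), integral_mul_const, hw_int, one_mul]
    rfl
  rw [hsub, ← integral_mul_const]
  refine norm_integral_le_of_norm_le (f := fun y => w y * (u.1 (x + y) - u.1 x))
    (hw_moment.mul_const L) (.of_forall fun y => ?_)
  rw [norm_mul, Real.norm_of_nonneg (hw_nonneg y), mul_assoc, mul_comm ‖y‖]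
  exact mul_le_mul_of_nonneg_left (hL x y) (hw_nonneg y)

lemma exists_abs_iterate_pd_add_sub_le (u : TestFun) (N : ℕ) :
    ∃ L : ℝ, ∀ j l, j + l ≤ N → ∀ x y,
      |(pd1^[j] (pd2^[l] u)).1 (x + y) - (pd1^[j] (pd2^[l] u)).1 x| ≤ L * ‖y‖ := by
  choose L hL_nonneg hL using exists_abs_testFun_add_sub_le
  refine ⟨∑ q ∈ Finset.range (N + 1) ×ˢ Finset.range (N + 1), L (pd1^[q.1] (pd2^[q.2] u)),
    fun j l hjl x y => (hL _ x y).trans (mul_le_mul_of_nonneg_right ?_ (norm_nonneg y))⟩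
  refine Finset.single_le_sum (f := fun q : ℕ × ℕ => L (pd1^[q.1] (pd2^[q.2] u)))
    (fun q _ => hL_nonneg _) (a := (j, l)) ?_
  simp only [Finset.mem_product, Finset.mem_range]
  omega

lemma tendsto_apply_corr (f : PeriodicDistribution) (u : TestFun) {w : ℕ → ℝ × ℝ → ℝ}
    (hw : ∀ n, Integrable (w n)) (hw_nonneg : ∀ n, 0 ≤ w n) (hw_int : ∀ n, ∫ y, w n y = 1)
    (hw_moment : ∀ n, Integrable fun y => w n y * ‖y‖)
    (hw_tendsto : Tendsto (fun n => ∫ y, w n y * ‖y‖) atTop (𝓝 0)) :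
    Tendsto (fun n => f.1 (corr (w n) (hw n) u)) atTop (𝓝 (f.1 u)) := by
  obtain ⟨C, N, hC⟩ := f.2
  obtain ⟨L, hL⟩ := exists_abs_iterate_pd_add_sub_le u N
  have bound (n : ℕ) :
      ‖f.1 (corr (w n) (hw n) u) - f.1 u‖ ≤ C * ((∫ y, w n y * ‖y‖) * L) := by
    rw [← map_sub]
    refine hC _ _ fun j l hjl x => ?_
    rw [iterate_map_sub, iterate_map_sub, iterate_pd_corr]
    exact abs_corr_sub_le (hw n) (hw_nonneg n) (hw_int n) (hw_moment n) (hL j l hjl) x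
  refine tendsto_iff_norm_sub_tendsto_zero.2 (squeeze_zero (fun _ => norm_nonneg _) bound ?_)
  simpa using (hw_tendsto.mul_const L).const_mul C

end ApproximateIdentity

section TrigPoly

/-- The space of real trigonometric polynomials on the torus. -/
def trigPoly : Submodule ℝ (ℝ × ℝ → ℝ) :=
  Submodule.span ℝ (range fun q : (ℤ × ℤ) × ℝ => (trig q.1 q.2).1)

lemma trig_mem_trigPoly (k : ℤ × ℤ) (φ : ℝ) : (trig k φ).1 ∈ trigPoly :=
  Submodule.subset_span ⟨(k, φ), rfl⟩

lemma trigPoly_le_testFun : trigPoly ≤ TestFun := by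
  rw [trigPoly, Submodule.span_le]
  rintro _ ⟨q, rfl⟩
  exact (trig q.1 q.2).2

lemma continuous_of_mem_trigPoly {w : ℝ × ℝ → ℝ} (hw : w ∈ trigPoly) : Continuous w :=
  continuous_testFun ⟨w, trigPoly_le_testFun hw⟩

lemma isPeriodic_of_mem_trigPoly {w : ℝ × ℝ → ℝ} (hw : w ∈ trigPoly) : IsPeriodic w :=
  isPeriodic_testFun ⟨w, trigPoly_le_testFun hw⟩

lemma one_mem_trigPoly : (1 : ℝ × ℝ → ℝ) ∈ trigPoly := by
  convert trig_mem_trigPoly 0 0 using 1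
  ext x
  simp [trig_apply, phase_zero_left]

lemma mul_mem_trigPoly {v w : ℝ × ℝ → ℝ} (hv : v ∈ trigPoly) (hw : w ∈ trigPoly) :
    v * w ∈ trigPoly := by
  suffices trigPoly * trigPoly ≤ trigPoly from this (Submodule.mul_mem_mul hv hw)
  conv_lhs => rw [trigPoly, Submodule.span_mul_span]
  rw [Submodule.span_le]
  rintro _ ⟨_, ⟨⟨k, φ⟩, rfl⟩, _, ⟨⟨l, ψ⟩, rfl⟩, rfl⟩
  have product : (trig k φ).1 * (trig l ψ).1 = (1 / 2 : ℝ) • (trig (k - l) (φ - ψ)).1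
      + (1 / 2 : ℝ) • (trig (k + l) (φ + ψ)).1 :=
    funext fun x => cos_phase_mul_cos_phase k l φ ψ x
  rw [SetLike.mem_coe]
  simp only [product]
  exact add_mem (Submodule.smul_mem _ _ (trig_mem_trigPoly _ _))
    (Submodule.smul_mem _ _ (trig_mem_trigPoly _ _))

lemma pow_mem_trigPoly {v : ℝ × ℝ → ℝ} (hv : v ∈ trigPoly) (n : ℕ) : v ^ n ∈ trigPoly := by
  induction n with
  | zero => simpa only [pow_zero] using one_mem_trigPoly
  | succ n ih => rw [pow_succ]; exact mul_mem_trigPoly ih hv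

lemma setIntegral_cos_phase_sub_mul {u : ℝ × ℝ → ℝ} (hu : Continuous u) (k : ℤ × ℤ) (φ : ℝ)
    (x : ℝ × ℝ) : ∫ y in unitCell, cos (phase k (y - x) + φ) * u y
      = (∫ y in unitCell, cos (phase k y + φ) * u y) * cos (phase k x)
        + (∫ y in unitCell, sin (phase k y + φ) * u y) * sin (phase k x) := by
  have hphase := (contDiff_phase k).continuous
  rw [← integral_mul_const, ← integral_mul_const,
    ← integral_add (integrableOn_unitCell (by fun_prop)) (integrableOn_unitCell (by fun_prop))]
  refine integral_congr_ae (.of_forall fun y => ?_)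
  have hphase : phase k (y - x) + φ = (phase k y + φ) - phase k x := by
    rw [eq_sub_iff_add_eq, add_right_comm, ← phase_add, sub_add_cancel]
  simp only [hphase, Real.cos_sub]
  ring

lemma setIntegral_sub_mul_mem_trigPoly {w u : ℝ × ℝ → ℝ} (hw : w ∈ trigPoly)
    (hu : Continuous u) : (fun x => ∫ y in unitCell, w (y - x) * u y) ∈ trigPoly := by
  have hint {w : ℝ × ℝ → ℝ} (hw : w ∈ trigPoly) (x : ℝ × ℝ) :
      IntegrableOn (fun y => w (y - x) * u y) unitCell :=
    integrableOn_unitCell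
      (((continuous_of_mem_trigPoly hw).comp (continuous_id.sub continuous_const)).mul hu)
  induction hw using Submodule.span_induction with
  | mem w h =>
    obtain ⟨⟨k, φ⟩, rfl⟩ := h
    have combination : (fun x => ∫ y in unitCell, (trig k φ).1 (y - x) * u y)
        = (∫ y in unitCell, cos (phase k y + φ) * u y) • (trig k 0).1
          + (∫ y in unitCell, sin (phase k y + φ) * u y) • (trig k (-(Real.pi / 2))).1 := by
      ext x
      simp only [trig_apply, setIntegral_cos_phase_sub_mul hu, Pi.add_apply, Pi.smul_apply,
        smul_eq_mul, add_zero, ← sub_eq_add_neg, Real.cos_sub_pi_div_two]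
    rw [combination]
    exact add_mem (Submodule.smul_mem _ _ (trig_mem_trigPoly _ _))
      (Submodule.smul_mem _ _ (trig_mem_trigPoly _ _))
  | zero =>
    simp only [Pi.zero_apply, zero_mul, integral_zero]
    exact trigPoly.zero_mem
  | add w w' hw hw' h h' =>
    simp only [Pi.add_apply, add_mul]
    convert add_mem h h' using 1
    exact funext fun x => integral_add (hint hw x) (hint hw' x)
  | smul c w _ h =>
    convert trigPoly.smul_mem c h using 1
    ext x
    simp only [Pi.smul_apply, smul_eq_mul, mul_assoc, integral_const_mul]

end TrigPoly

section PeakKernel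

/-- The closed cell centred at `0`. -/
def centredCell : Set (ℝ × ℝ) := Icc (-(1 / 2)) (1 / 2) ×ˢ Icc (-(1 / 2)) (1 / 2)

lemma isCompact_centredCell : IsCompact centredCell := isCompact_Icc.prod isCompact_Icc

lemma measurableSet_centredCell : MeasurableSet centredCell :=
  isCompact_centredCell.measurableSet

lemma zero_mem_interior_centredCell : (0 : ℝ × ℝ) ∈ interior centredCell := by
  rw [centredCell, interior_prod_eq, interior_Icc]
  simp

lemma IsPeriodic.setIntegral_centredCell {G : ℝ × ℝ → ℝ} (hp : IsPeriodic G)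
    (hG : Continuous G) : ∫ z in centredCell, G z = ∫ z in unitCell, G z := by
  rw [← hp.setIntegral_Ico_prod_eq hG (-(1 / 2)) (-(1 / 2)),
    show (-(1 / 2) + 1 : ℝ) = 1 / 2 by norm_num]
  exact setIntegral_congr_set (Measure.set_prod_ae_eq Ico_ae_eq_Icc Ico_ae_eq_Icc).symm

/-- A nonnegative trigonometric polynomial whose only maximum in `centredCell` is at `0`; its
normalised powers form an approximate identity. -/
def peak (y : ℝ × ℝ) : ℝ :=
  (1 / 2 + 1 / 2 * cos (2 * Real.pi * y.1)) * (1 / 2 + 1 / 2 * cos (2 * Real.pi * y.2))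

lemma peak_mem_trigPoly : peak ∈ trigPoly := by
  have factor (k : ℤ × ℤ) : (1 / 2 : ℝ) • (1 : ℝ × ℝ → ℝ) + (1 / 2 : ℝ) • (trig k 0).1 ∈ trigPoly :=
    add_mem (Submodule.smul_mem _ _ one_mem_trigPoly)
      (Submodule.smul_mem _ _ (trig_mem_trigPoly _ _))
  convert mul_mem_trigPoly (factor (1, 0)) (factor (0, 1)) using 1
  ext y
  simp [peak, trig_apply, phase]

lemma continuous_peak : Continuous peak := continuous_of_mem_trigPoly peak_mem_trigPoly

lemma half_add_half_mul_cos_nonneg (t : ℝ) : 0 ≤ 1 / 2 + 1 / 2 * cos t := by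
  linarith [Real.neg_one_le_cos t]

lemma peak_nonneg (y : ℝ × ℝ) : 0 ≤ peak y :=
  mul_nonneg (half_add_half_mul_cos_nonneg _) (half_add_half_mul_cos_nonneg _)

lemma peak_zero : peak 0 = 1 := by norm_num [peak]

lemma cos_two_pi_mul_lt_one {s : ℝ} (hs : s ∈ Icc (-(1 / 2) : ℝ) (1 / 2)) (h0 : s ≠ 0) :
    cos (2 * Real.pi * s) < 1 := by
  refine lt_of_le_of_ne (Real.cos_le_one _) fun h => h0 ?_
  rw [Real.cos_eq_one_iff_of_lt_of_lt (by nlinarith [hs.1, Real.pi_pos])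
    (by nlinarith [hs.2, Real.pi_pos])] at h
  simpa [Real.pi_ne_zero] using h

lemma peak_lt_one {y : ℝ × ℝ} (hy : y ∈ centredCell) (h0 : y ≠ 0) : peak y < 1 := by
  have le_one (t : ℝ) : 1 / 2 + 1 / 2 * cos t ≤ 1 := by linarith [Real.cos_le_one t]
  by_cases h1 : y.1 = 0
  · have h2 := cos_two_pi_mul_lt_one hy.2 fun h2 => h0 (Prod.ext h1 h2)
    exact mul_lt_one_of_nonneg_of_lt_one_right (le_one _) (half_add_half_mul_cos_nonneg _)
      (by linarith)
  · have h1 := cos_two_pi_mul_lt_one hy.1 h1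
    exact mul_lt_one_of_nonneg_of_lt_one_left (half_add_half_mul_cos_nonneg _) (by linarith)
      (le_one _)

lemma setIntegral_peak_pow_pos (n : ℕ) : 0 < ∫ y in centredCell, peak y ^ n := by
  have hc : Continuous fun y => peak y ^ n := continuous_peak.pow n
  refine (setIntegral_pos_iff_support_of_nonneg_ae
    (.of_forall fun y => pow_nonneg (peak_nonneg y) n)
    (hc.continuousOn.integrableOn_compact isCompact_centredCell)).2 ?_
  have hpos : 0 < volume (Function.support (fun y => peak y ^ n) ∩ interior centredCell) :=
    (hc.isOpen_support.inter isOpen_interior).measure_pos volume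
      ⟨0, by simp [peak_zero], zero_mem_interior_centredCell⟩
  exact hpos.trans_le (measure_mono (inter_subset_inter_right _ interior_subset))

/-- The normalised powers of `peak` on `centredCell`, an approximate identity. -/
def peakKernel (n : ℕ) : ℝ × ℝ → ℝ :=
  centredCell.indicator fun y => (∫ y in centredCell, peak y ^ n)⁻¹ * peak y ^ n

lemma peakKernel_mul (n : ℕ) (F : ℝ × ℝ → ℝ) : (fun y => peakKernel n y * F y)
    = centredCell.indicator fun y => (∫ y in centredCell, peak y ^ n)⁻¹ * (peak y ^ n * F y) := by
  ext y
  by_cases hy : y ∈ centredCell <;> simp [peakKernel, hy, mul_assoc]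

lemma integrable_peakKernel_mul (n : ℕ) {F : ℝ × ℝ → ℝ} (hF : Continuous F) :
    Integrable fun y => peakKernel n y * F y := by
  rw [peakKernel_mul]
  exact ((continuous_const.mul ((continuous_peak.pow n).mul hF)).continuousOn.integrableOn_compact
    isCompact_centredCell).integrable_indicator measurableSet_centredCell

lemma integral_peakKernel_mul (n : ℕ) (F : ℝ × ℝ → ℝ) : ∫ y, peakKernel n y * F y
    = (∫ y in centredCell, peak y ^ n)⁻¹ * ∫ y in centredCell, peak y ^ n * F y := by
  rw [peakKernel_mul, integral_indicator measurableSet_centredCell, integral_const_mul]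

lemma integrable_peakKernel (n : ℕ) : Integrable (peakKernel n) := by
  simpa only [mul_one] using integrable_peakKernel_mul n (F := fun _ => 1) continuous_const

lemma integral_peakKernel (n : ℕ) : ∫ y, peakKernel n y = 1 := by
  simpa only [mul_one, inv_mul_cancel₀ (setIntegral_peak_pow_pos n).ne'] using
    integral_peakKernel_mul n fun _ => 1

lemma peakKernel_nonneg (n : ℕ) : 0 ≤ peakKernel n :=
  indicator_nonneg fun y _ =>
    mul_nonneg (inv_nonneg.2 (setIntegral_peak_pow_pos n).le) (pow_nonneg (peak_nonneg y) n)

lemma tendsto_integral_peakKernel_mul_norm :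
    Tendsto (fun n => ∫ y, peakKernel n y * ‖y‖) atTop (𝓝 0) := by
  simpa only [integral_peakKernel_mul, smul_eq_mul, norm_zero] using
    tendsto_setIntegral_pow_smul_of_unique_maximum_of_isCompact_of_continuousOn
      (μ := (volume : Measure (ℝ × ℝ))) (x₀ := 0) (c := peak) (g := fun y : ℝ × ℝ => ‖y‖)
      isCompact_centredCell continuous_peak.continuousOn
      (fun y hy h0 => peak_zero.symm ▸ peak_lt_one hy h0) (fun y _ => peak_nonneg y)
      (peak_zero.symm ▸ one_pos) (subset_closure zero_mem_interior_centredCell)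
      continuous_norm.continuousOn

lemma corr_peakKernel_mem_trigPoly (n : ℕ) (u : TestFun) :
    (corr (peakKernel n) (integrable_peakKernel n) u).1 ∈ trigPoly := by
  have hpow := pow_mem_trigPoly peak_mem_trigPoly n
  convert trigPoly.smul_mem (∫ y in centredCell, peak y ^ n)⁻¹
    (setIntegral_sub_mul_mem_trigPoly hpow (continuous_testFun u)) using 1
  ext x
  have hperiodic : IsPeriodic fun y => (peak ^ n) y * u.1 (y + x) :=
    (isPeriodic_of_mem_trigPoly hpow).mul ((isPeriodic_testFun u).comp_add x)
  have hcont : Continuous fun y => (peak ^ n) y * u.1 (y + x) :=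
    (continuous_of_mem_trigPoly hpow).mul
      ((continuous_testFun u).comp (continuous_id.add continuous_const))
  calc ∫ y, peakKernel n y * u.1 (x + y)
      = (∫ y in centredCell, peak y ^ n)⁻¹ * ∫ y in unitCell, (peak ^ n) y * u.1 (y + x) := by
        rw [← hperiodic.setIntegral_centredCell hcont]
        simp only [integral_peakKernel_mul, Pi.pow_apply, add_comm x]
    _ = (∫ y in centredCell, peak y ^ n)⁻¹ * ∫ y in unitCell, (peak ^ n) (y - x) * u.1 y := by
        rw [← hperiodic.setIntegral_add hcont (-x)]
        simp only [← sub_eq_add_neg, sub_add_cancel]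

end PeakKernel

lemma apply_eq_zero_of_mem_trigPoly {f : PeriodicDistribution}
    (hf : ∀ k φ, f.1 (trig k φ) = 0) {u : TestFun} (hu : u.1 ∈ trigPoly) : f.1 u = 0 := by
  have hle : trigPoly ≤ (LinearMap.ker f.1).map TestFun.subtype := by
    rw [trigPoly, Submodule.span_le]
    rintro _ ⟨q, rfl⟩
    exact ⟨trig q.1 q.2, hf q.1 q.2, rfl⟩
  obtain ⟨v, hv, hvu⟩ := hle hu
  rwa [← Subtype.ext hvu]

theorem eq_zero_of_forall_trig {f : PeriodicDistribution} (hf : ∀ k φ, f.1 (trig k φ) = 0) :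
    f = 0 := by
  ext u
  have hlim := tendsto_apply_corr f u integrable_peakKernel peakKernel_nonneg integral_peakKernel
    (fun n => integrable_peakKernel_mul n continuous_norm) tendsto_integral_peakKernel_mul_norm
  simp only [apply_eq_zero_of_mem_trigPoly hf (corr_peakKernel_mem_trigPoly _ u)] at hlim
  exact tendsto_nhds_unique hlim tendsto_const_nhds

/-! ### Anisotropic Hölder bounds -/

section HolderBound

lemma anisoDist_nonneg (x y : ℝ × ℝ) : 0 ≤ anisoDist x y :=
  add_nonneg (abs_nonneg _) (Real.rpow_nonneg (abs_nonneg _) _)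

lemma anisoDist_rpow_nonneg (x y : ℝ × ℝ) (α : ℝ) : 0 ≤ anisoDist x y ^ α :=
  Real.rpow_nonneg (anisoDist_nonneg x y) α

lemma anisoDist_self (x : ℝ × ℝ) : anisoDist x x = 0 := by simp [anisoDist]

lemma anisoDist_pos {x y : ℝ × ℝ} (h : x ≠ y) : 0 < anisoDist x y := by
  by_cases h₁ : x.1 = y.1
  · have h₂ : x.2 ≠ y.2 := fun h₂ => h (Prod.ext h₁ h₂)
    exact add_pos_of_nonneg_of_pos (abs_nonneg _)
      (Real.rpow_pos_of_pos (abs_pos.2 (sub_ne_zero.2 h₂)) _)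
  · exact add_pos_of_pos_of_nonneg (abs_pos.2 (sub_ne_zero.2 h₁))
      (Real.rpow_nonneg (abs_nonneg _) _)

lemma anisoDist_sub_right (x y z : ℝ × ℝ) : anisoDist (x - z) (y - z) = anisoDist x y := by
  simp [anisoDist]

lemma anisoDist_sub_self (x y : ℝ × ℝ) : anisoDist (x - y) x = anisoDist y 0 := by
  simp [anisoDist]

lemma continuous_anisoDist_left (y : ℝ × ℝ) : Continuous fun x => anisoDist x y := by
  unfold anisoDist
  exact Continuous.add (by fun_prop)
    (Continuous.rpow_const (by fun_prop) fun _ => Or.inr (by norm_num))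

lemma continuous_anisoDist_rpow_left (y : ℝ × ℝ) {α : ℝ} (hα : 0 ≤ α) :
    Continuous fun x => anisoDist x y ^ α :=
  (continuous_anisoDist_left y).rpow_const fun _ => Or.inr hα

/-- `g` is a periodic function with Hölder seminorm `[g]_α ≤ B`. -/
structure HolderBound (α B : ℝ) (g : ℝ × ℝ → ℝ) : Prop where
  periodic : IsPeriodic g
  le : ∀ x y, |g y - g x| ≤ B * anisoDist y x ^ α

namespace HolderBound

variable {α B B' : ℝ} {g h : ℝ × ℝ → ℝ}

lemma nonneg (hg : HolderBound α B g) : 0 ≤ B := by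
  simpa [anisoDist] using (abs_nonneg _).trans (hg.le 0 (1, 0))

lemma mono (hg : HolderBound α B g) (h : B ≤ B') : HolderBound α B' g :=
  ⟨hg.periodic, fun x y => (hg.le x y).trans
    (mul_le_mul_of_nonneg_right h (anisoDist_rpow_nonneg y x α))⟩

lemma sub (hg : HolderBound α B g) (hh : HolderBound α B' h) :
    HolderBound α (B + B') (g - h) := by
  refine ⟨⟨fun x => congrArg₂ (· - ·) (hg.periodic.1 x) (hh.periodic.1 x),
    fun x => congrArg₂ (· - ·) (hg.periodic.2 x) (hh.periodic.2 x)⟩, fun x y => ?_⟩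
  calc |g y - h y - (g x - h x)| = |(g y - g x) - (h y - h x)| := by ring_nf
    _ ≤ |g y - g x| + |h y - h x| := abs_sub _ _
    _ ≤ (B + B') * anisoDist y x ^ α := by linarith [hg.le x y, hh.le x y]

lemma continuous (hg : HolderBound α B g) (hα : 0 < α) : Continuous g := by
  refine continuous_iff_continuousAt.2 fun x => tendsto_iff_dist_tendsto_zero.2 ?_
  have hd := (continuous_const.mul (continuous_anisoDist_rpow_left x hα.le)).tendsto (f :=
    fun y => B * anisoDist y x ^ α) x
  rw [anisoDist_self, Real.zero_rpow hα.ne', mul_zero] at hd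
  exact squeeze_zero (fun _ => dist_nonneg) (fun y => hg.le x y) hd

lemma holderPos_le (hg : HolderBound α B g) (hα : α ≤ 1) :
    holderPos α g ≤ ENNReal.ofReal B := by
  rw [holderPos, if_pos hα]
  refine iSup_le fun x => iSup_le fun y => iSup_le fun hxy => ENNReal.ofReal_le_ofReal ?_
  rw [div_le_iff₀ (Real.rpow_pos_of_pos (anisoDist_pos hxy.symm) _)]
  exact hg.le x y

/- Increments over distances below `ℓ` are controlled by the Hölder bound, all others by the
supremum. -/
lemma of_abs_le {δ ℓ D : ℝ} (hg : HolderBound α B g) (hδ : 0 ≤ δ) (hδα : δ ≤ α) (hℓ : 0 < ℓ)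
    (hD : ∀ x, |g x| ≤ D * ℓ ^ α) : HolderBound (α - δ) ((B + 2 * D) * ℓ ^ δ) g := by
  have hB := hg.nonneg
  have hD₀ : 0 ≤ D := nonneg_of_mul_nonneg_left ((abs_nonneg _).trans (hD 0)) (by positivity)
  have split {s : ℝ} (hs : 0 ≤ s) : s ^ α = s ^ δ * s ^ (α - δ) := by
    rw [← Real.rpow_add_of_nonneg hs hδ (sub_nonneg.2 hδα), add_sub_cancel]
  refine ⟨hg.periodic, fun x y => ?_⟩
  have hd := anisoDist_nonneg y x
  set d := anisoDist y x
  rcases le_total d ℓ with hdℓ | hℓd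
  · calc |g y - g x| ≤ B * (d ^ δ * d ^ (α - δ)) := split hd ▸ hg.le x y
      _ ≤ B * (ℓ ^ δ * d ^ (α - δ)) := by gcongr
      _ ≤ (B + 2 * D) * (ℓ ^ δ * d ^ (α - δ)) := by gcongr; linarith
      _ = _ := by ring
  · calc |g y - g x| ≤ |g y| + |g x| := abs_sub _ _
      _ ≤ 2 * D * (ℓ ^ δ * ℓ ^ (α - δ)) := by
          rw [← split hℓ.le]
          linarith [hD x, hD y]
      _ ≤ 2 * D * (ℓ ^ δ * d ^ (α - δ)) := by gcongr
      _ ≤ (B + 2 * D) * (ℓ ^ δ * d ^ (α - δ)) := by gcongr; linarith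
      _ = _ := by ring

end HolderBound

end HolderBound

/-! ### Averages of translates of Hölder functions -/

section TranslateAvg

variable {Y : Type} [MeasurableSpace Y] {ν : Measure Y} {w : Y → ℝ} {τ : Y → ℝ × ℝ}
  {g : ℝ × ℝ → ℝ}

/-- The average `x ↦ ∫ w(y) g(x - τ(y)) dν(y)` of translates of `g`. It covers both the convolution
`w * g` and the average of `g` in `x₁`. -/
def translateAvg (ν : Measure Y) (w : Y → ℝ) (τ : Y → ℝ × ℝ) (g : ℝ × ℝ → ℝ) (x : ℝ × ℝ) : ℝ :=
  ∫ y, w y * g (x - τ y) ∂ν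

lemma integrable_mul_comp_sub (hw : Integrable w ν) (hτ : Measurable τ) (hc : Continuous g)
    (hg : IsPeriodic g) (x : ℝ × ℝ) : Integrable (fun y => w y * g (x - τ y)) ν := by
  simpa only [sub_eq_add_neg, smul_eq_mul, Pi.neg_apply] using
    integrable_translates hw hc hg hτ.neg.stronglyMeasurable x

lemma isPeriodic_translateAvg (hg : IsPeriodic g) : IsPeriodic (translateAvg ν w τ g) := by
  simpa only [← sub_eq_add_neg, smul_eq_mul, ← translateAvg.eq_1] using
    isPeriodic_translates (ν := ν) (w := w) (τ := fun y => -τ y) hg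

lemma setIntegral_mul_translates [SFinite ν] (hw : Integrable w ν) (hτ : Measurable τ)
    (hc : Continuous g) (hg : IsPeriodic g) {v : ℝ × ℝ → ℝ} (hvc : Continuous v)
    (hv : IsPeriodic v) :
    ∫ x in unitCell, g x * ∫ y, w y * v (x + τ y) ∂ν
      = ∫ x in unitCell, translateAvg ν w τ g x * v x := by
  obtain ⟨b, hb⟩ := hg.exists_bound hc
  obtain ⟨b', hb'⟩ := hv.exists_bound hvc
  have integrable_prod {F : (ℝ × ℝ) × (ℝ × ℝ) → ℝ} (hF : Continuous F)
      (hF_le : ∀ z, ‖F z‖ ≤ b * b') :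
      Integrable (Function.uncurry fun x y => w y * F (x, τ y))
        ((volume.restrict unitCell).prod ν) := by
    have hm : Measurable fun z : (ℝ × ℝ) × Y => (z.1, τ z.2) := by fun_prop
    exact (hw.comp_snd _).mul_bdd (hF.measurable.comp hm).aestronglyMeasurable
      (Eventually.of_forall fun _ => hF_le _)
  have norm_le (a c : ℝ × ℝ) : ‖g a * v c‖ ≤ b * b' := by
    rw [norm_mul]
    exact mul_le_mul (hb a) (hb' c) (norm_nonneg _) ((norm_nonneg _).trans (hb a))
  calc ∫ x in unitCell, g x * ∫ y, w y * v (x + τ y) ∂ν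
      = ∫ x in unitCell, ∫ y, w y * (g x * v (x + τ y)) ∂ν := by
        simp only [← integral_const_mul, mul_left_comm]
    _ = ∫ y, (∫ x in unitCell, w y * (g x * v (x + τ y))) ∂ν :=
        integral_integral_swap (integrable_prod (F := fun z => g z.1 * v (z.1 + z.2))
          (by fun_prop) fun _ => norm_le _ _)
    _ = ∫ y, (∫ x in unitCell, w y * (g (x - τ y) * v x)) ∂ν := by
        refine integral_congr_ae (Eventually.of_forall fun y => ?_)
        have shift := ((hg.comp_add (-τ y)).mul hv).setIntegral_add (by fun_prop) (τ y)
        simp only [add_neg_cancel_right] at shift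
        simp only [integral_const_mul, shift, ← sub_eq_add_neg]
    _ = ∫ x in unitCell, ∫ y, w y * (g (x - τ y) * v x) ∂ν :=
        (integral_integral_swap (integrable_prod (F := fun z => g (z.1 - z.2) * v z.1)
          (by fun_prop) fun _ => norm_le _ _)).symm
    _ = ∫ x in unitCell, translateAvg ν w τ g x * v x := by
        simp only [translateAvg, ← integral_mul_const, mul_assoc]

namespace HolderBound

variable {α B : ℝ}

lemma translateAvg (hg : HolderBound α B g) (hα : 0 < α) (hw : Integrable w ν)
    (hτ : Measurable τ) :
    HolderBound α ((∫ y, |w y| ∂ν) * B) (translateAvg ν w τ g) := by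
  have hi := integrable_mul_comp_sub hw hτ (hg.continuous hα) hg.periodic
  refine ⟨isPeriodic_translateAvg hg.periodic, fun x y => ?_⟩
  rw [WhiteNoiseTorus.translateAvg, WhiteNoiseTorus.translateAvg, ← integral_sub (hi y) (hi x),
    mul_assoc, ← integral_mul_const]
  refine norm_integral_le_of_norm_le (f := fun z => w z * g (y - τ z) - w z * g (x - τ z))
    (hw.norm.mul_const (B * anisoDist y x ^ α)) (Eventually.of_forall fun z => ?_)
  rw [← mul_sub, norm_mul]
  refine mul_le_mul_of_nonneg_left ?_ (norm_nonneg _)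
  simpa only [anisoDist_sub_right, Real.norm_eq_abs] using hg.le (x - τ z) (y - τ z)

lemma abs_translateAvg_sub_le (hg : HolderBound α B g) (hα : 0 < α) (hw : Integrable w ν)
    (hw_one : ∫ y, w y ∂ν = 1) (hτ : Measurable τ)
    (hm : Integrable (fun y => |w y| * anisoDist (τ y) 0 ^ α) ν) (x : ℝ × ℝ) :
    |(WhiteNoiseTorus.translateAvg ν w τ g - g) x|
      ≤ B * ∫ y, |w y| * anisoDist (τ y) 0 ^ α ∂ν := by
  have hi := integrable_mul_comp_sub hw hτ (hg.continuous hα) hg.periodic x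
  have increment : (WhiteNoiseTorus.translateAvg ν w τ g - g) x
      = ∫ y, w y * (g (x - τ y) - g x) ∂ν := by
    simp only [mul_sub]
    rw [integral_sub hi (hw.mul_const _), integral_mul_const, hw_one, one_mul]
    rfl
  rw [increment, ← integral_const_mul]
  refine norm_integral_le_of_norm_le (f := fun y => w y * (g (x - τ y) - g x)) (hm.const_mul B)
    (Eventually.of_forall fun y => ?_)
  rw [norm_mul, mul_left_comm]
  refine mul_le_mul_of_nonneg_left ?_ (abs_nonneg _)
  simpa only [anisoDist_sub_self, Real.norm_eq_abs] using hg.le x (x - τ y)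

lemma translateAvg_sub {δ ℓ M : ℝ} (hg : HolderBound α B g) (hα : 0 < α) (hδ : 0 ≤ δ)
    (hδα : δ ≤ α) (hℓ : 0 < ℓ) (hw : Integrable w ν) (hw_one : ∫ y, w y ∂ν = 1)
    (hτ : Measurable τ) (hm : Integrable (fun y => |w y| * anisoDist (τ y) 0 ^ α) ν)
    (hM : ∫ y, |w y| * anisoDist (τ y) 0 ^ α ∂ν ≤ ℓ ^ α * M) :
    HolderBound (α - δ) (((∫ y, |w y| ∂ν) + 1 + 2 * M) * ℓ ^ δ * B)
      (WhiteNoiseTorus.translateAvg ν w τ g - g) := by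
  have hD (x : ℝ × ℝ) : |(WhiteNoiseTorus.translateAvg ν w τ g - g) x| ≤ B * M * ℓ ^ α :=
    calc _ ≤ B * (ℓ ^ α * M) := (hg.abs_translateAvg_sub_le hα hw hw_one hτ hm x).trans
          (mul_le_mul_of_nonneg_left hM hg.nonneg)
      _ = _ := by ring
  exact (((hg.translateAvg hα hw hτ).sub hg).of_abs_le hδ hδα hℓ hD).mono (by linarith)

end HolderBound

end TranslateAvg

/-! ### Hölder representations of distributions -/

section HolderRep

lemma integrableOn_mul_testFun {h : ℝ × ℝ → ℝ} (hc : Continuous h) (u : TestFun) :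
    IntegrableOn (fun x => h x * u.1 x) unitCell :=
  integrableOn_unitCell (hc.mul (continuous_testFun u))

/-- The distributional identity `f = c + ∂₁² g + ∂₂ h`. -/
def Represents (c : ℝ) (g h : ℝ × ℝ → ℝ) (f : PeriodicDistribution) : Prop :=
  ∀ u : TestFun, f.1 u = c * (∫ x in unitCell, u.1 x)
    + (∫ x in unitCell, g x * (pd1 (pd1 u)).1 x) - (∫ x in unitCell, h x * (pd2 u).1 x)

/-- The bound `[f]_β ≲ B`, witnessed by a representation `f = c + ∂₁² g + ∂₂ h` with `|c|`,
`[g]_{β+2}` and `[h]_{β+3/2}` at most `B`. -/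
def HasHolderRep (β B : ℝ) (f : PeriodicDistribution) : Prop :=
  ∃ c g h, |c| ≤ B ∧ HolderBound (β + 2) B g ∧ HolderBound (β + 3 / 2) B h ∧ Represents c g h f

variable {β B : ℝ} {f : PeriodicDistribution}

lemma HasHolderRep.nonneg (hf : HasHolderRep β B f) : 0 ≤ B := by
  obtain ⟨c, -, -, hc, -⟩ := hf
  exact (abs_nonneg c).trans hc

lemma HasHolderRep.holderNeg_le (hβ : β ≤ -1) (hf : HasHolderRep β B f) :
    holderNeg β f ≤ ENNReal.ofReal (3 * B) := by
  have hB := hf.nonneg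
  obtain ⟨c, g, h, hc, hg, hh, hr⟩ := hf
  rw [holderNeg, if_neg hβ.not_gt]
  refine iInf_le_of_le c <| iInf_le_of_le g <| iInf_le_of_le h <| iInf_le_of_le hg.periodic <|
    iInf_le_of_le hh.periodic <| iInf_le_of_le hr ?_
  calc _ ≤ ENNReal.ofReal B + ENNReal.ofReal B + ENNReal.ofReal B :=
        add_le_add (add_le_add (ENNReal.ofReal_le_ofReal hc) (hg.holderPos_le (by linarith)))
          (hh.holderPos_le (by linarith))
    _ = ENNReal.ofReal (3 * B) := by
        rw [← ENNReal.ofReal_add hB hB, ← ENNReal.ofReal_add (by positivity) hB]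
        ring_nf

lemma Represents.sub {c c' : ℝ} {g g' h h' : ℝ × ℝ → ℝ} {f' : PeriodicDistribution}
    (hf : Represents c g h f) (hf' : Represents c' g' h' f') (hg : Continuous g)
    (hg' : Continuous g') (hh : Continuous h) (hh' : Continuous h') :
    Represents (c - c') (g - g') (h - h') (f - f') := by
  intro u
  calc f.1 u - f'.1 u = _ := by rw [hf u, hf' u]
    _ = _ := by
      simp only [Pi.sub_apply, sub_mul]
      rw [integral_sub (integrableOn_mul_testFun hg _) (integrableOn_mul_testFun hg' _),
        integral_sub (integrableOn_mul_testFun hh _) (integrableOn_mul_testFun hh' _)]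
      ring

/-! #### Projection -/

/-- The average of a function in `x₁`, in the form `∫_{[0,1)} h(x - (s,0)) ds`, which for periodic
`h` equals `∫_{[0,1)} h(s,x₂) ds`. -/
def avgFst (h : ℝ × ℝ → ℝ) : ℝ × ℝ → ℝ :=
  translateAvg (volume.restrict (Ico (0 : ℝ) 1)) 1 (fun s => (s, 0)) h

lemma integrable_one_Ico : Integrable (1 : ℝ → ℝ) (volume.restrict (Ico (0 : ℝ) 1)) :=
  integrable_const 1

lemma avg1_apply (u : TestFun) (x : ℝ × ℝ) :
    (avg1 u).1 x = ∫ s in Ico (0 : ℝ) 1, (1 : ℝ → ℝ) s * u.1 (x + (s, 0)) := by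
  have shift : ∫ s in (0 : ℝ)..1, u.1 (s, x.2) = ∫ s in (0 : ℝ)..1, u.1 (x.1 + s, x.2) := by
    rw [intervalIntegral.integral_comp_add_left (fun s => u.1 (s, x.2)), add_zero]
    simpa only [zero_add] using
      ((isPeriodic_testFun u).periodic_fst x.2).intervalIntegral_add_eq 0 x.1
  change ∫ s in Ico (0 : ℝ) 1, u.1 (s, x.2) = _
  simpa [intervalIntegral.integral_of_le, integral_Ico_eq_integral_Ioc, Prod.add_def] using shift

lemma setIntegral_mul_avg1 {h : ℝ × ℝ → ℝ} (hc : Continuous h) (hp : IsPeriodic h)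
    (u : TestFun) :
    ∫ x in unitCell, h x * (avg1 u).1 x = ∫ x in unitCell, avgFst h x * u.1 x := by
  simp only [avg1_apply]
  exact setIntegral_mul_translates integrable_one_Ico (by fun_prop) hc hp (continuous_testFun u)
    (isPeriodic_testFun u)

lemma setIntegral_avg1 (u : TestFun) :
    ∫ x in unitCell, (avg1 u).1 x = ∫ x in unitCell, u.1 x := by
  simpa [avgFst, translateAvg] using
    setIntegral_mul_avg1 (h := fun _ => 1) continuous_const ⟨fun _ => rfl, fun _ => rfl⟩ u

lemma HolderBound.avgFst {α : ℝ} {h : ℝ × ℝ → ℝ} (hh : HolderBound α B h) (hα : 0 < α) :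
    HolderBound α B (avgFst h) := by
  simpa [← WhiteNoiseTorus.avgFst.eq_1] using
    hh.translateAvg hα integrable_one_Ico (τ := fun s => (s, 0)) (by fun_prop)

/- The constant drops out since `P` kills the mean, and `∂₁² g` is unaffected since `P` only
removes a function of `x₂`. -/
lemma Represents.proj {c : ℝ} {g h : ℝ × ℝ → ℝ} (hf : Represents c g h f) (hc : Continuous h)
    (hp : IsPeriodic h) (ha : Continuous (avgFst h)) :
    Represents 0 g (h - avgFst h) (proj f) := by
  intro u
  have mean : ∫ x in unitCell, (u - avg1 u).1 x = 0 :=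
    (integral_sub (integrableOn_unitCell (continuous_testFun u))
      (integrableOn_unitCell (continuous_testFun (avg1 u)))).trans
      (sub_eq_zero.2 (setIntegral_avg1 u).symm)
  have second : ∫ x in unitCell, h x * (pd2 (u - avg1 u)).1 x
      = ∫ x in unitCell, (h - avgFst h) x * (pd2 u).1 x := by
    rw [map_sub, pd2_avg1]
    simp only [Submodule.coe_sub, Pi.sub_apply, mul_sub, sub_mul]
    rw [integral_sub (integrableOn_mul_testFun hc _) (integrableOn_mul_testFun hc _),
      integral_sub (integrableOn_mul_testFun hc _) (integrableOn_mul_testFun ha _),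
      setIntegral_mul_avg1 hc hp]
  calc (WhiteNoiseTorus.proj f).1 u = f.1 (u - avg1 u) := rfl
    _ = _ := by rw [hf, mean, second, map_sub, pd1_avg1, sub_zero]; ring

lemma HasHolderRep.proj (hβ : -(3 / 2) < β) (hf : HasHolderRep β B f) :
    HasHolderRep β (2 * B) (proj f) := by
  have hB := hf.nonneg
  obtain ⟨c, g, h, -, hg, hh, hr⟩ := hf
  have hh' := hh.avgFst (by linarith)
  exact ⟨0, g, h - avgFst h, by simpa using hB, hg.mono (by linarith),
    two_mul B ▸ hh.sub hh', hr.proj (hh.continuous (by linarith)) hh.periodic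
      (hh'.continuous (by linarith))⟩

/-! #### Convolution -/

section Conv

variable {w : ℝ × ℝ → ℝ}

lemma setIntegral_mul_corr {g : ℝ × ℝ → ℝ} (hw : Integrable w) (hg : Continuous g)
    (hp : IsPeriodic g) (u : TestFun) :
    ∫ x in unitCell, g x * (corr w hw u).1 x
      = ∫ x in unitCell, translateAvg volume w id g x * u.1 x :=
  setIntegral_mul_translates hw measurable_id hg hp (continuous_testFun u) (isPeriodic_testFun u)

lemma setIntegral_corr (hw : Integrable w) (u : TestFun) :
    ∫ x in unitCell, (corr w hw u).1 x = (∫ y, w y) * ∫ x in unitCell, u.1 x := by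
  simpa [translateAvg, integral_const_mul] using
    setIntegral_mul_corr hw (g := fun _ => 1) continuous_const ⟨fun _ => rfl, fun _ => rfl⟩ u

lemma Represents.conv {c : ℝ} {g h : ℝ × ℝ → ℝ} (hf : Represents c g h f) (hw : Integrable w)
    (hg : Continuous g) (hgp : IsPeriodic g) (hh : Continuous h) (hhp : IsPeriodic h) :
    Represents (c * ∫ y, w y) (translateAvg volume w id g) (translateAvg volume w id h)
      (conv w hw f) := by
  intro u
  have h₁ : pd1 (pd1 (corr w hw u)) = corr w hw (pd1 (pd1 u)) := by
    rw [pd1, corr_dirDeriv, corr_dirDeriv]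
  have h₂ : pd2 (corr w hw u) = corr w hw (pd2 u) := corr_dirDeriv w hw (0, 1) u
  calc (WhiteNoiseTorus.conv w hw f).1 u = f.1 (corr w hw u) := rfl
    _ = _ := by
      rw [hf, h₁, h₂, setIntegral_mul_corr hw hg hgp, setIntegral_mul_corr hw hh hhp,
        setIntegral_corr, mul_assoc]

lemma HasHolderRep.conv (hβ : -(3 / 2) < β) (hf : HasHolderRep β B f) (hw : Integrable w) :
    HasHolderRep β ((∫ y, |w y|) * B) (conv w hw f) := by
  obtain ⟨c, g, h, hc, hg, hh, hr⟩ := hf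
  have hα : 0 < β + 2 := by linarith
  have hα' : 0 < β + 3 / 2 := by linarith
  refine ⟨_, _, _, ?_, hg.translateAvg hα hw measurable_id, hh.translateAvg hα' hw measurable_id,
    hr.conv hw (hg.continuous hα) hg.periodic (hh.continuous hα') hh.periodic⟩
  rw [abs_mul, mul_comm]
  exact mul_le_mul abs_integral_le_integral_abs hc (abs_nonneg _)
    (integral_nonneg fun _ => abs_nonneg _)

end Conv

/-! #### Mollification -/

section Mollify

variable {φ : 𝓢(ℝ × ℝ, ℝ)} {ℓ α : ℝ}

/-- The anisotropic dilation `x ↦ (x₁/ℓ, x₂/ℓ^{3/2})`. -/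
def anisoDilation (ℓ : ℝ) (x : ℝ × ℝ) : ℝ × ℝ := (x.1 / ℓ, x.2 / ℓ ^ (3 / 2 : ℝ))

lemma measurable_anisoDilation : Measurable (anisoDilation ℓ) := by
  unfold anisoDilation
  fun_prop

lemma map_anisoDilation (hℓ : 0 < ℓ) :
    Measure.map (anisoDilation ℓ) volume = ENNReal.ofReal (ℓ ^ (5 / 2 : ℝ)) • volume := by
  have hℓ' : 0 < ℓ ^ (3 / 2 : ℝ) := by positivity
  have hmul : ℓ ^ (5 / 2 : ℝ) = ℓ * ℓ ^ (3 / 2 : ℝ) := by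
    rw [← Real.rpow_one_add' hℓ.le (by norm_num)]
    norm_num
  have h := Measure.map_prod_map (volume : Measure ℝ) (volume : Measure ℝ)
    (measurable_const_mul ℓ⁻¹) (measurable_const_mul (ℓ ^ (3 / 2 : ℝ))⁻¹)
  rw [Real.map_volume_mul_left (inv_ne_zero hℓ.ne'),
    Real.map_volume_mul_left (inv_ne_zero hℓ'.ne'), Measure.prod_smul_left,
    Measure.prod_smul_right, smul_smul, inv_inv, inv_inv, abs_of_pos hℓ, abs_of_pos hℓ',
    ← ENNReal.ofReal_mul hℓ.le, ← hmul, ← Measure.volume_eq_prod] at h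
  rw [h]
  congr 1
  ext x : 1
  simp only [anisoDilation, Prod.map, div_eq_inv_mul]

lemma integrable_comp_anisoDilation {F : ℝ × ℝ → ℝ} (hF : Integrable F) (hℓ : 0 < ℓ) :
    Integrable fun x => F (anisoDilation ℓ x) := by
  refine Integrable.comp_measurable ?_ measurable_anisoDilation
  rw [map_anisoDilation hℓ]
  exact hF.smul_measure ENNReal.ofReal_ne_top

lemma integral_comp_anisoDilation {F : ℝ × ℝ → ℝ} (hF : Integrable F) (hℓ : 0 < ℓ) :
    ∫ x, F (anisoDilation ℓ x) = ℓ ^ (5 / 2 : ℝ) * ∫ x, F x := by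
  have hF' : AEStronglyMeasurable F (Measure.map (anisoDilation ℓ) volume) := by
    rw [map_anisoDilation hℓ]
    exact hF.1.smul_measure _
  rw [← integral_map measurable_anisoDilation.aemeasurable hF', map_anisoDilation hℓ,
    integral_smul_measure, ENNReal.toReal_ofReal (by positivity), smul_eq_mul]

lemma anisoDist_anisoDilation (hℓ : 0 < ℓ) (y : ℝ × ℝ) :
    anisoDist y 0 = ℓ * anisoDist (anisoDilation ℓ y) 0 := by
  have h : 0 < ℓ ^ (3 / 2 : ℝ) := by positivity
  simp only [anisoDilation, anisoDist, Prod.fst_zero, Prod.snd_zero, sub_zero, abs_div,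
    abs_of_pos hℓ, abs_of_pos h]
  rw [Real.div_rpow (abs_nonneg _) h.le, ← Real.rpow_mul hℓ.le]
  norm_num
  field_simp

lemma integral_rescale (φ : 𝓢(ℝ × ℝ, ℝ)) (hℓ : 0 < ℓ) : ∫ x, rescale φ ℓ x = ∫ x, φ x := by
  have : 0 < ℓ ^ (5 / 2 : ℝ) := by positivity
  calc ∫ x, rescale φ ℓ x = ∫ x, 1 / ℓ ^ (5 / 2 : ℝ) * φ (anisoDilation ℓ x) := rfl
    _ = ∫ x, φ x := by
      rw [integral_const_mul, integral_comp_anisoDilation φ.integrable hℓ]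
      field_simp

/-- The absolute moment `∫ |φ(x)| d(x,0)^α dx`. -/
def absMoment (φ : ℝ × ℝ → ℝ) (α : ℝ) : ℝ := ∫ x, |φ x| * anisoDist x 0 ^ α

lemma absMoment_nonneg (φ : ℝ × ℝ → ℝ) (α : ℝ) : 0 ≤ absMoment φ α :=
  integral_nonneg fun x => mul_nonneg (abs_nonneg _) (anisoDist_rpow_nonneg x 0 α)

lemma anisoDist_zero_le (x : ℝ × ℝ) : anisoDist x 0 ≤ 1 + 2 * ‖x‖ := by
  have h₁ : |x.1| ≤ ‖x‖ := norm_fst_le x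
  have h₂ : |x.2| ≤ ‖x‖ := norm_snd_le x
  have h₃ : |x.2| ^ (2 / 3 : ℝ) ≤ 1 + |x.2| :=
    calc |x.2| ^ (2 / 3 : ℝ) ≤ (1 + |x.2|) ^ (2 / 3 : ℝ) := by gcongr; linarith
      _ ≤ 1 + |x.2| := Real.rpow_le_self_of_one_le (by simp) (by norm_num)
  simp only [anisoDist, Prod.fst_zero, Prod.snd_zero, sub_zero]
  linarith

lemma integrable_abs_mul_anisoDist_rpow (φ : 𝓢(ℝ × ℝ, ℝ)) (hα : 0 ≤ α) :
    Integrable fun x => |φ x| * anisoDist x 0 ^ α := by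
  set n := ⌈α⌉₊
  have growth (x : ℝ × ℝ) : anisoDist x 0 ^ α ≤ 2 ^ (n - 1) * (1 + 2 ^ n * ‖x‖ ^ n) := by
    calc anisoDist x 0 ^ α ≤ (1 + 2 * ‖x‖) ^ α :=
          Real.rpow_le_rpow (anisoDist_nonneg x 0) (anisoDist_zero_le x) hα
      _ ≤ (1 + 2 * ‖x‖) ^ (n : ℝ) :=
          Real.rpow_le_rpow_of_exponent_le (by linarith [norm_nonneg x]) (Nat.le_ceil α)
      _ ≤ _ := by
          rw [Real.rpow_natCast]
          simpa [mul_pow] using add_pow_le (zero_le_one' ℝ) (by positivity : 0 ≤ 2 * ‖x‖) n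
  have dominating : Integrable fun x => 2 ^ (n - 1) * (‖φ x‖ + 2 ^ n * (‖x‖ ^ n * ‖φ x‖)) :=
    (φ.integrable.norm.add ((φ.integrable_pow_mul volume n).const_mul _)).const_mul _
  refine dominating.mono' (φ.continuous.abs.mul
    (continuous_anisoDist_rpow_left 0 hα)).aestronglyMeasurable (Eventually.of_forall fun x => ?_)
  rw [Real.norm_of_nonneg (mul_nonneg (abs_nonneg _) (anisoDist_rpow_nonneg x 0 α))]
  calc |φ x| * anisoDist x 0 ^ α ≤ |φ x| * (2 ^ (n - 1) * (1 + 2 ^ n * ‖x‖ ^ n)) :=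
        mul_le_mul_of_nonneg_left (growth x) (abs_nonneg _)
    _ = _ := by rw [← Real.norm_eq_abs]; ring

lemma abs_rescale_mul_anisoDist_rpow (φ : 𝓢(ℝ × ℝ, ℝ)) (hℓ : 0 < ℓ) (α : ℝ) (x : ℝ × ℝ) :
    |rescale φ ℓ x| * anisoDist x 0 ^ α = ℓ ^ α / ℓ ^ (5 / 2 : ℝ) *
      (|φ (anisoDilation ℓ x)| * anisoDist (anisoDilation ℓ x) 0 ^ α) := by
  rw [anisoDist_anisoDilation hℓ x, Real.mul_rpow hℓ.le (anisoDist_nonneg _ _), rescale, abs_mul,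
    abs_of_pos (by positivity : 0 < 1 / ℓ ^ (5 / 2 : ℝ)), anisoDilation]
  ring

lemma integrable_abs_rescale_mul_anisoDist_rpow (φ : 𝓢(ℝ × ℝ, ℝ)) (hℓ : 0 < ℓ) (hα : 0 ≤ α) :
    Integrable fun x => |rescale φ ℓ x| * anisoDist x 0 ^ α := by
  simpa only [abs_rescale_mul_anisoDist_rpow φ hℓ] using
    (integrable_comp_anisoDilation (integrable_abs_mul_anisoDist_rpow φ hα) hℓ).const_mul _

lemma absMoment_rescale (φ : 𝓢(ℝ × ℝ, ℝ)) (hℓ : 0 < ℓ) (hα : 0 ≤ α) :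
    absMoment (rescale φ ℓ) α = ℓ ^ α * absMoment φ α := by
  have : 0 < ℓ ^ (5 / 2 : ℝ) := by positivity
  simp only [absMoment, abs_rescale_mul_anisoDist_rpow φ hℓ]
  rw [integral_const_mul,
    integral_comp_anisoDilation (integrable_abs_mul_anisoDist_rpow φ hα) hℓ]
  field_simp

lemma integral_abs_rescale (φ : 𝓢(ℝ × ℝ, ℝ)) (hℓ : 0 < ℓ) :
    ∫ x, |rescale φ ℓ x| = ∫ x, |φ x| := by
  simpa [absMoment] using absMoment_rescale φ hℓ le_rfl

lemma HolderBound.translateAvg_rescale_sub {δ : ℝ} {g : ℝ × ℝ → ℝ} (hg : HolderBound α B g)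
    (hα : 0 < α) (hδ : 0 ≤ δ) (hδα : δ ≤ α) (hφ : ∫ x, φ x = 1) (hℓ : 0 < ℓ) :
    HolderBound (α - δ) (((∫ x, |φ x|) + 1 + 2 * absMoment φ α) * ℓ ^ δ * B)
      (WhiteNoiseTorus.translateAvg volume (rescale φ ℓ) id g - g) := by
  rw [← integral_abs_rescale φ hℓ]
  exact hg.translateAvg_sub hα hδ hδα hℓ (integrable_rescale φ hℓ)
    ((integral_rescale φ hℓ).trans hφ) measurable_id
    (integrable_abs_rescale_mul_anisoDist_rpow φ hℓ hα.le) (absMoment_rescale φ hℓ hα.le).le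

lemma HasHolderRep.proj_mollify (hβ : -(3 / 2) < β) (hf : HasHolderRep β B f)
    (φ : 𝓢(ℝ × ℝ, ℝ)) (hℓ : 0 < ℓ) :
    HasHolderRep β (2 * ((∫ x, |φ x|) * B)) (WhiteNoiseTorus.proj (mollify φ ℓ hℓ f)) :=
  (integral_abs_rescale φ hℓ ▸ hf.conv hβ (integrable_rescale φ hℓ)).proj hβ

/-- The constant in the rate `‖φ_ℓ * f - f‖ ≲ ℓ^δ ‖f‖` for a representation of order `β`. -/
def mollifyConst (φ : 𝓢(ℝ × ℝ, ℝ)) (β : ℝ) : ℝ :=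
  (∫ x, |φ x|) + 1 + 2 * (absMoment φ (β + 2) + absMoment φ (β + 3 / 2))

lemma mollifyConst_nonneg (φ : 𝓢(ℝ × ℝ, ℝ)) (β : ℝ) : 0 ≤ mollifyConst φ β := by
  have h₁ := absMoment_nonneg φ (β + 2)
  have h₂ := absMoment_nonneg φ (β + 3 / 2)
  unfold mollifyConst
  positivity

lemma HasHolderRep.mollify_sub {δ : ℝ} (hβ : -(3 / 2) < β) (hδ : 0 ≤ δ)
    (hf : HasHolderRep (β + δ) B f) (hφ : ∫ x, φ x = 1) (hℓ : 0 < ℓ) :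
    HasHolderRep β (mollifyConst φ (β + δ) * ℓ ^ δ * B) (mollify φ ℓ hℓ f - f) := by
  have hB : 0 ≤ ℓ ^ δ * B := mul_nonneg (by positivity) hf.nonneg
  obtain ⟨c, g, h, -, hg, hh, hr⟩ := hf
  have hα : 0 < β + δ + 2 := by linarith
  have hα' : 0 < β + δ + 3 / 2 := by linarith
  have hw := integrable_rescale φ hℓ
  have le_const {M : ℝ} (hM : M ≤ absMoment φ (β + δ + 2) + absMoment φ (β + δ + 3 / 2)) :
      ((∫ x, |φ x|) + 1 + 2 * M) * ℓ ^ δ * B ≤ mollifyConst φ (β + δ) * ℓ ^ δ * B := by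
    rw [mul_assoc, mul_assoc, mollifyConst]
    gcongr
  refine ⟨0, translateAvg volume (rescale φ ℓ) id g - g,
    translateAvg volume (rescale φ ℓ) id h - h, ?_, ?_, ?_, ?_⟩
  · rw [abs_zero, mul_assoc]
    exact mul_nonneg (mollifyConst_nonneg φ _) hB
  · simpa only [add_sub_right_comm _ (2 : ℝ), add_sub_cancel_right] using
      (hg.translateAvg_rescale_sub hα hδ (by linarith) hφ hℓ).mono
        (le_const (le_add_of_nonneg_right (absMoment_nonneg φ _)))
  · simpa only [add_sub_right_comm _ (3 / 2 : ℝ), add_sub_cancel_right] using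
      (hh.translateAvg_rescale_sub hα' hδ (by linarith) hφ hℓ).mono
        (le_const (le_add_of_nonneg_left (absMoment_nonneg φ _)))
  · have hgc := hg.continuous hα
    have hhc := hh.continuous hα'
    simpa [mollify, integral_rescale φ hℓ, hφ] using
      (hr.conv hw hgc hg.periodic hhc hh.periodic).sub hr
        ((hg.translateAvg hα hw measurable_id).continuous hα) hgc
        ((hh.translateAvg hα' hw measurable_id).continuous hα') hhc

end Mollify

end HolderRep

/-! ### Fourier multipliers -/

section FourierField

variable (f : PeriodicDistribution) (S : Finset (ℤ × ℤ)) (a b : ℤ × ℤ → ℝ) (k l : ℤ × ℤ)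
  (c φ ψ : ℝ) (x v : ℝ × ℝ)

/-- The kernel `y ↦ ∑ k ∈ S, a k cos (2π k·(x - y) + φ)` of a Fourier multiplier, written with
`cos (-t) = cos t` so that it is a combination of trigonometric test functions in `y`. -/
def fourierKernel : TestFun := ∑ k ∈ S, a k • trig k (-(phase k x + φ))

/-- The function `x ↦ f (y ↦ ∑ k ∈ S, a k cos (2π k·(x - y) + φ))`, that is, the Fourier multiplier
with symbol `a` on the frequencies in `S` and phase shift `φ`, applied to the distribution `f`. -/
def fourierField : ℝ := f.1 (fourierKernel S a φ x)

lemma fourierKernel_apply (y : ℝ × ℝ) :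
    (fourierKernel S a φ x).1 y = ∑ k ∈ S, a k * cos (phase k y + -(phase k x + φ)) := by
  simp [fourierKernel, trig_apply]

lemma fourierField_eq_sum :
    fourierField f S a φ x = ∑ k ∈ S, a k * f.1 (trig k (-(phase k x + φ))) := by
  simp [fourierField, fourierKernel, map_sum]

lemma fourierField_const_mul :
    fourierField f S (fun k => c * a k) φ x = c * fourierField f S a φ x := by
  simp only [fourierField_eq_sum, Finset.mul_sum, mul_assoc]

lemma fourierField_add :
    fourierField f S (fun k => a k + b k) φ x
      = fourierField f S a φ x + fourierField f S b φ x := by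
  simp only [fourierField_eq_sum, add_mul, Finset.sum_add_distrib]

lemma apply_trig : f.1 (trig k φ)
    = cos φ * f.1 (trig k 0) + sin φ * f.1 (trig k (Real.pi / 2)) := by
  rw [trig_eq_cos_smul_add_sin_smul, map_add, map_smul, map_smul, smul_eq_mul, smul_eq_mul]

lemma abs_apply_trig_le :
    |f.1 (trig k φ)| ≤ |f.1 (trig k 0)| + |f.1 (trig k (Real.pi / 2))| := by
  rw [apply_trig]
  refine (abs_add_le _ _).trans (add_le_add ?_ ?_) <;> rw [abs_mul]
  · exact mul_le_of_le_one_left (abs_nonneg _) (Real.abs_cos_le_one φ)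
  · exact mul_le_of_le_one_left (abs_nonneg _) (Real.abs_sin_le_one φ)

lemma apply_trig_neg_phase_add : f.1 (trig k (-(phase k x + φ)))
    = f.1 (trig k 0) * cos (phase k x + φ)
      + f.1 (trig k (Real.pi / 2)) * cos (phase k x + (φ + Real.pi / 2)) := by
  rw [apply_trig, Real.cos_neg, Real.sin_neg, ← add_assoc, Real.cos_add_pi_div_two]
  ring

lemma isPeriodic_fourierField : IsPeriodic (fourierField f S a φ) := by
  have hcos (k : ℤ × ℤ) (θ : ℝ) := isPeriodic_cos_phase k θ
  constructor <;> intro x <;> simp only [fourierField_eq_sum, apply_trig_neg_phase_add,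
    (hcos _ _).1 x, (hcos _ _).2 x]

lemma continuous_fourierField : Continuous (fourierField f S a φ) := by
  simp only [funext (fourierField_eq_sum f S a φ), apply_trig_neg_phase_add]
  have hcos := continuous_cos_phase
  fun_prop

lemma hasDerivAt_apply_trig_neg (θ : ℝ) :
    HasDerivAt (fun θ => f.1 (trig k (-θ))) (f.1 (trig k (-(θ + Real.pi / 2)))) θ := by
  have h := ((Real.hasDerivAt_cos θ).mul_const (f.1 (trig k 0))).fun_sub
    ((Real.hasDerivAt_sin θ).mul_const (f.1 (trig k (Real.pi / 2))))
  simp only [apply_trig f k (-_), Real.cos_neg, Real.sin_neg, neg_mul, ← sub_eq_add_neg,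
    Real.cos_add_pi_div_two, Real.sin_add_pi_div_two]
  simpa only [neg_mul] using h

lemma hasDerivAt_fourierField_line (t : ℝ) :
    HasDerivAt (fun t : ℝ => fourierField f S a φ (x + t • v))
      (fourierField f S (fun k => phase k v * a k) (φ + Real.pi / 2) (x + t • v)) t := by
  simp only [fourierField_eq_sum]
  refine HasDerivAt.fun_sum fun k _ => ?_
  have hphase (t : ℝ) : phase k (x + t • v) = phase k x + t * phase k v := by
    simp only [phase, Prod.fst_add, Prod.snd_add, Prod.smul_fst, Prod.smul_snd, smul_eq_mul]
    ring
  have hline : HasDerivAt (fun t => phase k (x + t • v) + φ) (phase k v) t := by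
    simp only [hphase]
    simpa using (((hasDerivAt_id t).mul_const (phase k v)).const_add (phase k x)).add_const φ
  refine (((hasDerivAt_apply_trig_neg f k _).comp t hline).const_mul (a k)).congr_deriv ?_
  rw [add_assoc]
  ring

variable {f S a φ v} in
lemma abs_fourierField_add_sub_le {D : ℝ}
    (hD : ∀ y, |fourierField f S (fun k => phase k v * a k) (φ + Real.pi / 2) y| ≤ D) :
    |fourierField f S a φ (x + v) - fourierField f S a φ x| ≤ D := by
  simpa using convex_univ.norm_image_sub_le_of_norm_hasDerivWithin_le (𝕜 := ℝ)
    (f := fun t : ℝ => fourierField f S a φ (x + t • v)) (x := 0) (y := 1)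
    (fun t _ => (hasDerivAt_fourierField_line f S a φ x v t).hasDerivWithinAt)
    (fun t _ => hD (x + t • v)) (mem_univ _) (mem_univ _)

variable {f S a} in
lemma abs_fourierField_le_card_mul {A B : ℝ} (ha : ∀ k ∈ S, |a k| ≤ A)
    (hf : ∀ k ∈ S, ∀ ψ, |f.1 (trig k ψ)| ≤ B) : |fourierField f S a φ x| ≤ S.card * (A * B) := by
  rw [fourierField_eq_sum, ← nsmul_eq_mul]
  refine (Finset.abs_sum_le_sum_abs _ _).trans (Finset.sum_le_card_nsmul _ _ _ fun k hk => ?_)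
  rw [abs_mul]
  exact mul_le_mul (ha k hk) (hf k hk _) (abs_nonneg _) ((abs_nonneg _).trans (ha k hk))

lemma setIntegral_apply_trig_mul_trig :
    ∫ x in unitCell, f.1 (trig k (-(phase k x + φ))) * (trig l ψ).1 x
      = (if k = l then f.1 (trig l (ψ - φ)) / 2 else 0)
        + (if k = -l then f.1 (trig l (ψ + φ)) / 2 else 0) := by
  have hint (c θ : ℝ) : IntegrableOn (fun x => c * (cos (phase k x + θ) * cos (phase l x + ψ)))
      unitCell := integrableOn_unitCell (continuous_const.mul
        ((continuous_cos_phase k θ).mul (continuous_cos_phase l ψ)))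
  simp only [apply_trig_neg_phase_add, trig_apply, add_mul, mul_assoc]
  rw [integral_add (hint _ _) (hint _ _), integral_const_mul, integral_const_mul,
    setIntegral_cos_phase_mul_cos_phase, setIntegral_cos_phase_mul_cos_phase]
  have diag : f.1 (trig k 0) * (cos (φ - ψ) / 2)
      + f.1 (trig k (Real.pi / 2)) * (cos (φ + Real.pi / 2 - ψ) / 2)
      = f.1 (trig k (ψ - φ)) / 2 := by
    rw [apply_trig f k (ψ - φ), ← neg_sub φ ψ, Real.cos_neg, Real.sin_neg,
      add_sub_right_comm, Real.cos_add_pi_div_two]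
    ring
  have antidiag : f.1 (trig k 0) * (cos (φ + ψ) / 2)
      + f.1 (trig k (Real.pi / 2)) * (cos (φ + Real.pi / 2 + ψ) / 2)
      = f.1 (trig (-k) (ψ + φ)) / 2 := by
    rw [trig_neg, apply_trig f k (-(ψ + φ)), Real.cos_neg, Real.sin_neg, add_right_comm,
      Real.cos_add_pi_div_two, add_comm ψ]
    ring
  have hneg : k = -l → l = -k := fun h => by rw [h, neg_neg]
  split_ifs with h₁ h₂ h₂
  · rw [mul_add, mul_add, add_add_add_comm, diag, antidiag, ← hneg h₂, ← h₁]
  · rw [add_zero, add_zero, add_zero, diag, ← h₁]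
  · rw [zero_add, zero_add, zero_add, antidiag, ← hneg h₂]
  · simp

lemma setIntegral_fourierField_mul_trig :
    ∫ x in unitCell, fourierField f S a φ x * (trig l ψ).1 x
      = (if l ∈ S then a l * (f.1 (trig l (ψ - φ)) / 2) else 0)
        + (if -l ∈ S then a (-l) * (f.1 (trig l (ψ + φ)) / 2) else 0) := by
  have hint (k : ℤ × ℤ) : IntegrableOn
      (fun x => a k * (f.1 (trig k (-(phase k x + φ))) * (trig l ψ).1 x)) unitCell := by
    simp only [apply_trig_neg_phase_add]
    have hcos := continuous_cos_phase
    have htrig := continuous_testFun (trig l ψ)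
    exact integrableOn_unitCell (by fun_prop)
  simp only [fourierField_eq_sum, Finset.sum_mul, mul_assoc]
  rw [integral_finsetSum _ fun k _ => hint k]
  simp only [integral_const_mul, setIntegral_apply_trig_mul_trig, mul_add, mul_ite, mul_zero,
    Finset.sum_add_distrib, Finset.sum_ite_eq']

variable {S a}

lemma setIntegral_fourierField_mul_trig_of_even (hS : ∀ k, -k ∈ S ↔ k ∈ S)
    (ha : ∀ k, a (-k) = a k) :
    ∫ x in unitCell, fourierField f S a 0 x * (trig l ψ).1 x
      = if l ∈ S then a l * f.1 (trig l ψ) else 0 := by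
  simp only [setIntegral_fourierField_mul_trig, hS, ha, sub_zero, add_zero]
  split_ifs <;> ring

lemma setIntegral_fourierField_mul_trig_of_odd (hS : ∀ k, -k ∈ S ↔ k ∈ S)
    (ha : ∀ k, a (-k) = -a k) :
    ∫ x in unitCell, fourierField f S a (-(Real.pi / 2)) x * (trig l ψ).1 x
      = if l ∈ S then a l * f.1 (trig l (ψ + Real.pi / 2)) else 0 := by
  have hshift : ψ + Real.pi / 2 = ψ + -(Real.pi / 2) + Real.pi := by ring
  simp only [setIntegral_fourierField_mul_trig, hS, ha, sub_neg_eq_add, hshift, trig_add_pi,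
    map_neg]
  split_ifs <;> ring

end FourierField

/-- The Schur test. -/
lemma sum_sum_mul_le_sum_sq {ι : Type*} {S : Finset ι} {w c : ι → ι → ℝ} (a : ι → ℝ)
    (hw_symm : ∀ i j, w i j = w j i) (hw_sum : ∀ i ∈ S, ∑ j ∈ S, w i j ≤ 1)
    (hc : ∀ i j, |c i j| ≤ w i j) :
    ∑ i ∈ S, ∑ j ∈ S, a i * a j * c i j ≤ ∑ i ∈ S, a i ^ 2 := by
  have hterm (i j : ι) :
      a i * a j * c i j ≤ 1 / 2 * (a i ^ 2 * w i j) + 1 / 2 * (a j ^ 2 * w j i) :=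
    calc a i * a j * c i j ≤ |a i| * |a j| * w i j := by
          rw [← abs_mul]
          exact (le_abs_self _).trans ((abs_mul _ _).trans_le
            (mul_le_mul_of_nonneg_left (hc i j) (abs_nonneg _)))
      _ ≤ 1 / 2 * (a i ^ 2 * w i j) + 1 / 2 * (a j ^ 2 * w j i) := by
          rw [hw_symm j i, ← sq_abs (a i), ← sq_abs (a j)]
          nlinarith [two_mul_le_add_sq |a i| |a j|, (abs_nonneg _).trans (hc i j)]
  have hrow : ∑ i ∈ S, ∑ j ∈ S, a i ^ 2 * w i j ≤ ∑ i ∈ S, a i ^ 2 :=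
    Finset.sum_le_sum fun i hi => by
      rw [← Finset.mul_sum]
      exact mul_le_of_le_one_right (sq_nonneg _) (hw_sum i hi)
  calc ∑ i ∈ S, ∑ j ∈ S, a i * a j * c i j
      ≤ ∑ i ∈ S, ∑ j ∈ S, (1 / 2 * (a i ^ 2 * w i j) + 1 / 2 * (a j ^ 2 * w j i)) :=
        Finset.sum_le_sum fun i _ => Finset.sum_le_sum fun j _ => hterm i j
    _ = ∑ i ∈ S, ∑ j ∈ S, a i ^ 2 * w i j := by
        simp only [Finset.sum_add_distrib, ← Finset.mul_sum]
        rw [Finset.sum_comm (f := fun i j => a j ^ 2 * w j i)]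
        simp only [← Finset.mul_sum]
        ring
    _ ≤ ∑ i ∈ S, a i ^ 2 := hrow

lemma setIntegral_sq_fourierKernel_le (S : Finset (ℤ × ℤ)) (a : ℤ × ℤ → ℝ) (φ : ℝ) (x : ℝ × ℝ) :
    ∫ y in unitCell, (fourierKernel S a φ x).1 y ^ 2 ≤ ∑ k ∈ S, a k ^ 2 := by
  have hint (k l : ℤ × ℤ) : IntegrableOn (fun y => a k * a l *
      (cos (phase k y + -(phase k x + φ)) * cos (phase l y + -(phase l x + φ)))) unitCell :=
    integrableOn_unitCell (continuous_const.mul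
      ((continuous_cos_phase k _).mul (continuous_cos_phase l _)))
  simp only [fourierKernel_apply, sq (Finset.sum _ _), Finset.sum_mul_sum, mul_mul_mul_comm]
  rw [integral_finsetSum _ fun k _ => integrable_finsetSum _ fun l _ => hint k l]
  simp only [integral_finsetSum _ fun l _ => hint _ l, integral_const_mul,
    setIntegral_cos_phase_mul_cos_phase]
  refine sum_sum_mul_le_sum_sq (w := fun k l => (if k = l then 1 / 2 else 0)
    + (if k = -l then 1 / 2 else 0)) a (fun k l => ?_) (fun k hk => ?_) (fun k l => ?_)
  · simp only [eq_comm (a := k) (b := l), eq_neg_iff_add_eq_zero, add_comm k]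
  · simp only [Finset.sum_add_distrib, Finset.sum_ite_eq, ← neg_eq_iff_eq_neg]
    split_ifs <;> norm_num
  · have hcos (t : ℝ) : |cos t / 2| ≤ 1 / 2 := by
      rw [abs_div, abs_two]
      linarith [Real.abs_cos_le_one t]
    refine (abs_add_le _ _).trans (add_le_add ?_ ?_) <;> split_ifs
    exacts [hcos _, abs_zero.le, hcos _, abs_zero.le]

/-! ### Anisotropic dyadic shells -/

/-- The frequencies with `|k₁| < 4^j` and `|k₂| < 8^j`. -/
def freqBox (j : ℕ) : Finset (ℤ × ℤ) :=
  Finset.Ioo (-4 ^ j) (4 ^ j) ×ˢ Finset.Ioo (-8 ^ j) (8 ^ j)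

lemma mem_freqBox {j : ℕ} {k : ℤ × ℤ} : k ∈ freqBox j ↔ |k.1| < 4 ^ j ∧ |k.2| < 8 ^ j := by
  simp [freqBox, abs_lt]

lemma card_freqBox_le (j : ℕ) : (freqBox j).card ≤ 4 * 32 ^ j := by
  have hcard (m : ℕ) : (Finset.Ioo (-(m : ℤ)) m).card ≤ 2 * m := by
    rw [Int.card_Ioo]
    omega
  have h4 := hcard (4 ^ j)
  have h8 := hcard (8 ^ j)
  push_cast at h4 h8
  calc (freqBox j).card ≤ 2 * 4 ^ j * (2 * 8 ^ j) := by
        rw [freqBox, Finset.card_product]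
        exact Nat.mul_le_mul h4 h8
    _ = 4 * 32 ^ j := by
        rw [mul_mul_mul_comm, ← mul_pow]
        norm_num

lemma freqBox_mono : Monotone freqBox := fun i j h k hk => by
  rw [mem_freqBox] at hk ⊢
  exact ⟨hk.1.trans_le (pow_le_pow_right₀ (by norm_num) h),
    hk.2.trans_le (pow_le_pow_right₀ (by norm_num) h)⟩

lemma exists_mem_freqBox (k : ℤ × ℤ) : ∃ j, k ∈ freqBox j := by
  have h {n b : ℕ} {m : ℤ} (hb : 1 < b) (hm : m.natAbs ≤ n) : |m| < (b : ℤ) ^ n := by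
    rw [Int.abs_eq_natAbs]
    exact_mod_cast hm.trans_lt (Nat.lt_pow_self hb)
  exact ⟨k.1.natAbs + k.2.natAbs, mem_freqBox.2 ⟨h (b := 4) (by norm_num) (Nat.le_add_right _ _),
    h (b := 8) (by norm_num) (Nat.le_add_left _ _)⟩⟩

/-- The dyadic shell of frequencies `k` with `max |k₁| |k₂|^(2/3)` about `4^j`. -/
def shell (j : ℕ) : Finset (ℤ × ℤ) := freqBox (j + 1) \ freqBox j

lemma neg_mem_shell (j : ℕ) (k : ℤ × ℤ) : -k ∈ shell j ↔ k ∈ shell j := by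
  simp [shell, mem_freqBox]

lemma card_shell_le (j : ℕ) : (shell j).card ≤ 4 * 32 ^ (j + 1) :=
  (Finset.card_le_card Finset.sdiff_subset).trans (card_freqBox_le (j + 1))

lemma zero_notMem_shell (j : ℕ) : (0 : ℤ × ℤ) ∉ shell j := by
  simp [shell, mem_freqBox]

lemma exists_mem_shell {k : ℤ × ℤ} (hk : k ≠ 0) : ∃ j, k ∈ shell j := by
  classical
  have hex := exists_mem_freqBox k
  have h0 : k ∉ freqBox 0 := fun h => by
    simp only [mem_freqBox, pow_zero, Int.abs_lt_one_iff] at h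
    exact hk (Prod.ext h.1 h.2)
  obtain ⟨j, hj⟩ := Nat.exists_eq_succ_of_ne_zero fun h => h0 (h ▸ Nat.find_spec hex)
  have hspec := Nat.find_spec hex
  rw [hj] at hspec
  exact ⟨j, Finset.mem_sdiff.2 ⟨hspec, Nat.find_min hex (by omega)⟩⟩

lemma shell_unique {i j : ℕ} {k : ℤ × ℤ} (hi : k ∈ shell i) (hj : k ∈ shell j) : i = j := by
  by_contra h
  rw [shell, Finset.mem_sdiff] at hi hj
  rcases lt_or_gt_of_ne h with h | h
  · exact hj.2 (freqBox_mono h hi.1)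
  · exact hi.2 (freqBox_mono h hj.1)

lemma one_add_abs_le_of_mem_shell {j : ℕ} {k : ℤ × ℤ} (hk : k ∈ shell j) :
    1 + |(k.1 : ℝ)| ≤ 4 ^ (j + 1) ∧ 1 + |(k.2 : ℝ)| ≤ 8 ^ (j + 1) := by
  obtain ⟨h1, h2⟩ := mem_freqBox.1 (Finset.mem_sdiff.1 hk).1
  rw [add_comm 1, add_comm 1]
  exact ⟨by exact_mod_cast Int.add_one_le_of_lt h1, by exact_mod_cast Int.add_one_le_of_lt h2⟩

lemma hasSum_shell_ite (k : ℤ × ℤ) (c : ℝ) :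
    HasSum (fun j => if k ∈ shell j then c else 0) (if k = 0 then 0 else c) := by
  split_ifs with hk
  · simpa only [hk, zero_notMem_shell, if_false] using hasSum_zero
  · obtain ⟨i, hi⟩ := exists_mem_shell hk
    have hmem (j : ℕ) : k ∈ shell j ↔ j = i := ⟨(shell_unique · hi), (· ▸ hi)⟩
    simpa only [hmem] using hasSum_ite_eq i c

/-! ### Supremum bounds from values on a grid -/

lemma IsPeriodic.apply_fract {E : Type*} {G : ℝ × ℝ → E} (hG : IsPeriodic G) (x : ℝ × ℝ) :
    G (Int.fract x.1, Int.fract x.2) = G x := by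
  have h1 := (hG.periodic_fst (Int.fract x.2)).sub_int_mul_eq (x := x.1) ⌊x.1⌋
  have h2 := (hG.periodic_snd x.1).sub_int_mul_eq (x := x.2) ⌊x.2⌋
  rw [mul_one, Int.self_sub_floor] at h1 h2
  exact h1.trans h2

lemma exists_fin_abs_sub_div_le {N : ℕ} {s : ℝ} (hN : 0 < N) (hs : 0 ≤ s) (hs1 : s < 1) :
    ∃ n : Fin N, |s - (n : ℕ) / (N : ℝ)| ≤ 1 / N := by
  have hN' : (0 : ℝ) < N := by exact_mod_cast hN
  have hsN : 0 ≤ s * N := by positivity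
  have hlt : ⌊s * N⌋₊ < N := by
    rw [Nat.floor_lt hsN]
    exact mul_lt_of_lt_one_left hN' hs1
  refine ⟨⟨⌊s * N⌋₊, hlt⟩, ?_⟩
  have h_eq : s - (⌊s * N⌋₊ : ℝ) / N = (s * N - ⌊s * N⌋₊) / N := by field_simp
  rw [h_eq, abs_of_nonneg (div_nonneg (sub_nonneg.2 (Nat.floor_le hsN)) hN'.le)]
  gcongr
  linarith [Nat.lt_floor_add_one (s * N)]

/-- The points of the grid of mesh `1 / N` in the unit cell. -/
def gridPoint {N : ℕ} (q : Fin N × Fin N) : ℝ × ℝ := ((q.1 : ℕ) / (N : ℝ), (q.2 : ℕ) / (N : ℝ))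

lemma IsPeriodic.abs_le_of_gridPoint {G : ℝ × ℝ → ℝ} (hG : IsPeriodic G) {N : ℕ} (hN : 0 < N)
    {D L : ℝ} (hL : 0 ≤ L) (hD : ∀ q : Fin N × Fin N, |G (gridPoint q)| ≤ D)
    (h_lip : ∀ y z, |G y - G z| ≤ L * ‖y - z‖) (x : ℝ × ℝ) : |G x| ≤ D + L / N := by
  obtain ⟨n, hn⟩ := exists_fin_abs_sub_div_le hN (Int.fract_nonneg x.1) (Int.fract_lt_one x.1)
  obtain ⟨m, hm⟩ := exists_fin_abs_sub_div_le hN (Int.fract_nonneg x.2) (Int.fract_lt_one x.2)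
  rw [← hG.apply_fract x]
  set y : ℝ × ℝ := (Int.fract x.1, Int.fract x.2)
  have h_near : |G y - G (gridPoint (n, m))| ≤ L / N :=
    (h_lip _ _).trans (by
      rw [div_eq_mul_one_div]
      exact mul_le_mul_of_nonneg_left (max_le hn hm) hL)
  linarith [abs_sub_abs_le_abs_sub (G y) (G (gridPoint (n, m))), hD (n, m)]

/-- The weight `(1 + |k₁|) (1 + |k₂|)` of the frequency `k`. -/
def freqWeight (k : ℤ × ℤ) : ℝ := (1 + |(k.1 : ℝ)|) * (1 + |(k.2 : ℝ)|)

lemma freqWeight_pos (k : ℤ × ℤ) : 0 < freqWeight k := by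
  unfold freqWeight
  positivity

lemma freqWeight_le_of_mem_shell {j : ℕ} {k : ℤ × ℤ} (hk : k ∈ shell j) :
    freqWeight k ≤ 32 ^ (j + 1) := by
  obtain ⟨h1, h2⟩ := one_add_abs_le_of_mem_shell hk
  calc freqWeight k ≤ 4 ^ (j + 1) * 8 ^ (j + 1) := by unfold freqWeight; gcongr
    _ = 32 ^ (j + 1) := by rw [← mul_pow]; norm_num

/-- A polynomial bound on the Fourier coefficients of `f`, used only to compare the values of a
Fourier multiplier at nearby points. -/
def CoefBound (B : ℝ) (f : PeriodicDistribution) : Prop :=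
  ∀ k φ, |f.1 (trig k φ)| ≤ B * freqWeight k

section Grid

variable {f : PeriodicDistribution} {A B : ℝ} {a : ℤ × ℤ → ℝ} {j : ℕ}

lemma CoefBound.nonneg (hf : CoefBound B f) : 0 ≤ B :=
  nonneg_of_mul_nonneg_left ((abs_nonneg _).trans (hf 0 0)) (freqWeight_pos 0)

lemma abs_phase_le_of_mem_shell {k : ℤ × ℤ} (hk : k ∈ shell j) (v : ℝ × ℝ) :
    |phase k v| ≤ 4 * Real.pi * 8 ^ (j + 1) * ‖v‖ := by
  obtain ⟨h1, h2⟩ := one_add_abs_le_of_mem_shell hk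
  have h48 : (4 : ℝ) ^ (j + 1) ≤ 8 ^ (j + 1) := by gcongr; norm_num
  calc |phase k v| ≤ 2 * Real.pi * (|(k.1 : ℝ)| * |v.1| + |(k.2 : ℝ)| * |v.2|) := by
        rw [phase, abs_mul, abs_of_pos Real.two_pi_pos, ← abs_mul, ← abs_mul]
        exact mul_le_mul_of_nonneg_left (abs_add_le _ _) Real.two_pi_pos.le
    _ ≤ 2 * Real.pi * (8 ^ (j + 1) * ‖v‖ + 8 ^ (j + 1) * ‖v‖) := by
        gcongr
        exacts [by linarith, norm_fst_le v, by linarith, norm_snd_le v]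
    _ = 4 * Real.pi * 8 ^ (j + 1) * ‖v‖ := by ring

lemma CoefBound.abs_fourierField_sub_le (hf : CoefBound B f) (hA : 0 ≤ A)
    (ha : ∀ k ∈ shell j, |a k| ≤ A) (φ : ℝ) (y z : ℝ × ℝ) :
    |fourierField f (shell j) a φ y - fourierField f (shell j) a φ z|
      ≤ 16 * Real.pi * (A * B) * 8192 ^ (j + 1) * ‖y - z‖ := by
  have hB := hf.nonneg
  have ha' : ∀ k ∈ shell j, |phase k (y - z) * a k|
      ≤ 4 * Real.pi * 8 ^ (j + 1) * ‖y - z‖ * A := fun k hk => by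
    rw [abs_mul]
    exact mul_le_mul (abs_phase_le_of_mem_shell hk _) (ha k hk) (abs_nonneg _) (by positivity)
  have hf' : ∀ k ∈ shell j, ∀ ψ, |f.1 (trig k ψ)| ≤ B * 32 ^ (j + 1) := fun k hk ψ =>
    (hf k ψ).trans (mul_le_mul_of_nonneg_left (freqWeight_le_of_mem_shell hk) hB)
  have h := abs_fourierField_add_sub_le z
    (abs_fourierField_le_card_mul (φ + Real.pi / 2) · ha' hf')
  rw [add_sub_cancel] at h
  calc _ ≤ ((shell j).card : ℝ) *
        (4 * Real.pi * 8 ^ (j + 1) * ‖y - z‖ * A * (B * 32 ^ (j + 1))) := h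
    _ ≤ (4 * 32 ^ (j + 1)) *
        (4 * Real.pi * 8 ^ (j + 1) * ‖y - z‖ * A * (B * 32 ^ (j + 1))) := by
        gcongr
        exact_mod_cast card_shell_le j
    _ = 16 * Real.pi * (A * B) * (32 * 8 * 32) ^ (j + 1) * ‖y - z‖ := by
        rw [mul_pow, mul_pow]; ring
    _ = 16 * Real.pi * (A * B) * 8192 ^ (j + 1) * ‖y - z‖ := by norm_num

/-- The number of grid points per unit length used for the shell `j`. It makes up for the factor
`8192 ^ (j + 1)` in `CoefBound.abs_fourierField_sub_le`. -/
def gridSize (j : ℕ) : ℕ := 8192 ^ (j + 1)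

lemma CoefBound.abs_fourierField_le_of_gridPoint (hf : CoefBound B f) (hA : 0 ≤ A)
    (ha : ∀ k ∈ shell j, |a k| ≤ A) (φ : ℝ) {D : ℝ}
    (hD : ∀ q : Fin (gridSize j) × Fin (gridSize j),
      |fourierField f (shell j) a φ (gridPoint q)| ≤ D) (x : ℝ × ℝ) :
    |fourierField f (shell j) a φ x| ≤ D + 16 * Real.pi * (A * B) := by
  have hB := hf.nonneg
  have h := (isPeriodic_fourierField f (shell j) a φ).abs_le_of_gridPoint
    (pow_pos (by norm_num) _) (by positivity) hD (hf.abs_fourierField_sub_le hA ha φ) x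
  rwa [Nat.cast_pow, Nat.cast_ofNat, mul_div_cancel_right₀ _ (by positivity)] at h

end Grid

/-! ### Sums of dyadic blocks -/

section BlockBound

lemma hasSum_four_rpow {s : ℝ} (hs : 0 < s) :
    HasSum (fun j : ℕ => (4 : ℝ) ^ (-s * j)) (1 - (4 : ℝ) ^ (-s))⁻¹ := by
  simpa only [Real.rpow_mul_natCast (by norm_num : (0 : ℝ) ≤ 4)] using
    hasSum_geometric_of_lt_one (by positivity)
      (Real.rpow_lt_one_of_one_lt_of_neg (by norm_num : (1 : ℝ) < 4) (neg_neg_of_pos hs))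

lemma four_rpow_three_halves_mul (j : ℕ) : (4 : ℝ) ^ (3 / 2 * j : ℝ) = 8 ^ j := by
  rw [Real.rpow_mul_natCast (by norm_num), show (4 : ℝ) = 2 ^ (2 : ℝ) by norm_num,
    ← Real.rpow_mul (by norm_num)]
  norm_num

lemma four_rpow_two_mul (j : ℕ) : (4 : ℝ) ^ (2 * j : ℝ) = (4 ^ j) ^ 2 := by
  rw [mul_comm, Real.rpow_natCast_mul (by norm_num), Real.rpow_two]

lemma abs_fst_sub_le_anisoDist (x y : ℝ × ℝ) : |y.1 - x.1| ≤ anisoDist y x :=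
  le_add_of_nonneg_right (Real.rpow_nonneg (abs_nonneg _) _)

lemma abs_snd_sub_le_anisoDist_rpow (x y : ℝ × ℝ) : |y.2 - x.2| ≤ anisoDist y x ^ (3 / 2 : ℝ) := by
  calc |y.2 - x.2| = (|y.2 - x.2| ^ (2 / 3 : ℝ)) ^ (3 / 2 : ℝ) := by
        rw [← Real.rpow_mul (abs_nonneg _)]
        norm_num
    _ ≤ anisoDist y x ^ (3 / 2 : ℝ) := by
        gcongr
        exact le_add_of_nonneg_left (abs_nonneg _)

/- Increments over distances below `4 ^ (-j)` are controlled by the Lipschitz bound, all others by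
the supremum. -/
lemma abs_sub_le_anisoDist_rpow {F : ℝ × ℝ → ℝ} {D α : ℝ} (hα : 0 ≤ α) (hα1 : α ≤ 1) (j : ℕ)
    (h_abs : ∀ x, |F x| ≤ D)
    (h_sub : ∀ x y, |F y - F x| ≤ D * (4 ^ j * |y.1 - x.1| + 8 ^ j * |y.2 - x.2|)) (x y : ℝ × ℝ) :
    |F y - F x| ≤ 2 * D * ((4 : ℝ) ^ (α * j) * anisoDist y x ^ α) := by
  have hD : 0 ≤ D := (abs_nonneg _).trans (h_abs x)
  have hd := anisoDist_nonneg y x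
  have h_scale (s : ℝ) : (4 : ℝ) ^ (s * j) * anisoDist y x ^ s = (4 ^ j * anisoDist y x) ^ s := by
    rw [Real.mul_rpow (by positivity) hd, mul_comm s, Real.rpow_natCast_mul (by norm_num)]
  have h_fst : 4 ^ j * |y.1 - x.1| ≤ (4 ^ j * anisoDist y x) ^ (1 : ℝ) := by
    rw [Real.rpow_one]
    gcongr
    exact abs_fst_sub_le_anisoDist x y
  have h_snd : 8 ^ j * |y.2 - x.2| ≤ (4 ^ j * anisoDist y x) ^ (3 / 2 : ℝ) := by
    rw [← h_scale, four_rpow_three_halves_mul]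
    gcongr
    exact abs_snd_sub_le_anisoDist_rpow x y
  rw [h_scale]
  have ht : 0 ≤ 4 ^ j * anisoDist y x := by positivity
  set t := 4 ^ j * anisoDist y x
  rcases le_total t 1 with h | h
  · calc |F y - F x| ≤ D * (t ^ α + t ^ α) := (h_sub x y).trans <| by
          gcongr
          · exact h_fst.trans (Real.rpow_le_rpow_of_exponent_ge' ht h hα hα1)
          · exact h_snd.trans (Real.rpow_le_rpow_of_exponent_ge' ht h hα (by linarith))
      _ = 2 * D * t ^ α := by ring
  · calc |F y - F x| ≤ |F y| + |F x| := abs_sub _ _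
      _ ≤ 2 * D := by linarith [h_abs x, h_abs y]
      _ ≤ 2 * D * t ^ α := le_mul_of_one_le_right (by positivity) (Real.one_le_rpow h hα)

/-- `F j` is a periodic function of size `4 ^ (-γ * j)` on the spatial scale `4 ^ (-j)`, up to the
factor `D`: the `j`-th dyadic block of a distribution of regularity `γ` satisfies such a bound. -/
structure BlockBound (γ D : ℝ) (F : ℕ → ℝ × ℝ → ℝ) : Prop where
  periodic : ∀ j, IsPeriodic (F j)
  continuous : ∀ j, Continuous (F j)
  abs_le : ∀ j x, |F j x| ≤ D * (4 : ℝ) ^ (-γ * j)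
  abs_sub_le : ∀ j x y,
    |F j y - F j x| ≤ D * (4 : ℝ) ^ (-γ * j) * (4 ^ j * |y.1 - x.1| + 8 ^ j * |y.2 - x.2|)

namespace BlockBound

variable {γ D α : ℝ} {F : ℕ → ℝ × ℝ → ℝ}

lemma mono {D' : ℝ} (hF : BlockBound γ D F) (h : D ≤ D') : BlockBound γ D' F where
  periodic := hF.periodic
  continuous := hF.continuous
  abs_le j x := (hF.abs_le j x).trans (by gcongr)
  abs_sub_le j x y := (hF.abs_sub_le j x y).trans (by gcongr)

lemma rpow_mul (hF : BlockBound γ D F) (s : ℝ) :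
    BlockBound (γ + s) D (fun j x => (4 : ℝ) ^ (-s * j) * F j x) := by
  have h_pos (j : ℕ) : (0 : ℝ) < 4 ^ (-s * j : ℝ) := by positivity
  have h_exp (j : ℕ) : (4 : ℝ) ^ (-(γ + s) * j : ℝ) = 4 ^ (-s * j : ℝ) * 4 ^ (-γ * j : ℝ) := by
    rw [← Real.rpow_add (by norm_num)]
    ring_nf
  refine ⟨fun j => ⟨fun x => congrArg (_ * ·) ((hF.periodic j).1 x),
    fun x => congrArg (_ * ·) ((hF.periodic j).2 x)⟩,
    fun j => continuous_const.mul (hF.continuous j), fun j x => ?_, fun j x y => ?_⟩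
  · rw [abs_mul, abs_of_pos (h_pos j), h_exp, mul_left_comm]
    exact mul_le_mul_of_nonneg_left (hF.abs_le j x) (h_pos j).le
  · rw [← mul_sub, abs_mul, abs_of_pos (h_pos j), h_exp, mul_left_comm D, mul_assoc]
    exact mul_le_mul_of_nonneg_left (hF.abs_sub_le j x y) (h_pos j).le

lemma summable (hF : BlockBound γ D F) (hγ : 0 < γ) (x : ℝ × ℝ) : Summable fun j => F j x :=
  ((hasSum_four_rpow hγ).summable.mul_left D).of_norm_bounded fun j => hF.abs_le j x

lemma holderBound_tsum (hF : BlockBound γ D F) (hα : 0 ≤ α) (hα1 : α ≤ 1) (hαγ : α < γ) :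
    HolderBound α (2 * D * (1 - (4 : ℝ) ^ (-(γ - α)))⁻¹) (fun x => ∑' j, F j x) := by
  refine ⟨⟨fun x => tsum_congr fun j => (hF.periodic j).1 x,
    fun x => tsum_congr fun j => (hF.periodic j).2 x⟩, fun x y => ?_⟩
  have hs := hF.summable (hα.trans_lt hαγ)
  rw [← (hs y).tsum_sub (hs x)]
  refine tsum_of_norm_bounded (E := ℝ) (((hasSum_four_rpow (sub_pos.2 hαγ)).mul_left
    (2 * D)).mul_right (anisoDist y x ^ α)) fun j => ?_
  refine (abs_sub_le_anisoDist_rpow hα hα1 j (hF.abs_le j) (hF.abs_sub_le j) x y).trans_eq ?_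
  rw [show -(γ - α) * (j : ℝ) = -γ * j + α * j by ring, Real.rpow_add (by norm_num)]
  ring

lemma hasSum_setIntegral_mul (hF : BlockBound γ D F) (hγ : 0 < γ) (u : TestFun) :
    HasSum (fun j => ∫ x in unitCell, F j x * u.1 x) (∫ x in unitCell, (∑' j, F j x) * u.1 x) := by
  obtain ⟨b, hb⟩ := (isPeriodic_testFun u).exists_bound (continuous_testFun u)
  have h_int (j : ℕ) := integrableOn_mul_testFun (hF.continuous j) u
  have h_norm (j : ℕ) : ∫ x in unitCell, ‖F j x * u.1 x‖ ≤ D * (4 : ℝ) ^ (-γ * j) * b := by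
    refine (integral_mono (h_int j).norm (integrable_const (D * (4 : ℝ) ^ (-γ * j) * b))
      fun x => ?_).trans_eq (by simp)
    rw [norm_mul]
    exact mul_le_mul (hF.abs_le j x) (hb x) (norm_nonneg _) ((abs_nonneg _).trans (hF.abs_le j x))
  simpa only [tsum_mul_right] using hasSum_integral_of_summable_integral_norm h_int
    (.of_nonneg_of_le (fun j => integral_nonneg fun x => norm_nonneg _) h_norm
      (((hasSum_four_rpow hγ).summable.mul_left D).mul_right b))

end BlockBound

end BlockBound

/-! ### Representations tested on trigonometric functions -/

section OfRep

variable {c : ℝ} {g h : ℝ × ℝ → ℝ}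

lemma abs_setIntegral_mul_le {b B : ℝ} {v : ℝ × ℝ → ℝ} (hb : ∀ x, ‖g x‖ ≤ b)
    (hv : ∀ x, |v x| ≤ B) : |∫ x in unitCell, g x * v x| ≤ b * B := by
  have h := norm_integral_le_of_norm_le_const (μ := volume.restrict unitCell)
    (f := fun x => g x * v x) (C := b * B) (.of_forall fun x => (norm_mul_le _ _).trans
      (mul_le_mul (hb x) (hv x) (norm_nonneg _) ((norm_nonneg _).trans (hb x))))
  simpa using h

/-- The periodic distribution `c + ∂₁² g + ∂₂ h`. -/
def ofRep (c : ℝ) (hg : Continuous g) (hgp : IsPeriodic g) (hh : Continuous h)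
    (hhp : IsPeriodic h) : PeriodicDistribution :=
  ⟨{ toFun := fun u => c * (∫ x in unitCell, u.1 x)
        + (∫ x in unitCell, g x * (pd1 (pd1 u)).1 x) - (∫ x in unitCell, h x * (pd2 u).1 x)
     map_add' := fun u v => by
        simp only [map_add, Submodule.coe_add, Pi.add_apply, mul_add]
        rw [integral_add (integrableOn_unitCell (continuous_testFun u))
          (integrableOn_unitCell (continuous_testFun v)),
          integral_add (integrableOn_mul_testFun hg _) (integrableOn_mul_testFun hg _),
          integral_add (integrableOn_mul_testFun hh _) (integrableOn_mul_testFun hh _)]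
        ring
     map_smul' := fun a u => by
        simp only [map_smul, Submodule.coe_smul, Pi.smul_apply, smul_eq_mul, mul_left_comm _ a,
          integral_const_mul, RingHom.id_apply]
        ring }, by
    obtain ⟨b, hb⟩ := hgp.exists_bound hg
    obtain ⟨b', hb'⟩ := hhp.exists_bound hh
    refine ⟨|c| + b + b', 2, fun u B hB => ?_⟩
    have h_c := abs_setIntegral_mul_le (g := fun _ => c) (fun _ => le_rfl)
      (hB 0 0 (by norm_num))
    have h_g := abs_setIntegral_mul_le hb (hB 2 0 (by norm_num))
    have h_h := abs_setIntegral_mul_le hb' (hB 0 1 (by norm_num))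
    rw [integral_const_mul] at h_c
    rw [add_mul, add_mul]
    exact (abs_sub _ _).trans (add_le_add ((abs_add_le _ _).trans (add_le_add h_c h_g)) h_h)⟩

lemma represents_of_forall_trig {f : PeriodicDistribution} (hg : Continuous g) (hgp : IsPeriodic g)
    (hh : Continuous h) (hhp : IsPeriodic h)
    (hf : ∀ k φ, f.1 (trig k φ) = c * (∫ x in unitCell, (trig k φ).1 x)
      + (∫ x in unitCell, g x * (pd1 (pd1 (trig k φ))).1 x)
      - (∫ x in unitCell, h x * (pd2 (trig k φ)).1 x)) :
    Represents c g h f := by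
  have h_eq : f = ofRep c hg hgp hh hhp :=
    sub_eq_zero.1 (eq_zero_of_forall_trig fun k φ => sub_eq_zero.2 (hf k φ))
  exact fun u => congrArg (fun f => f.1 u) h_eq

end OfRep

/-! ### Dyadic Fourier multipliers -/

/-- A family of real Fourier multipliers, one for each dyadic shell: the symbols `coef j` and a
common phase shift. -/
structure Multiplier where
  coef : ℕ → ℤ × ℤ → ℝ
  shift : ℝ

namespace Multiplier

variable (m : Multiplier) (f : PeriodicDistribution) (j : ℕ) (x : ℝ × ℝ)

/-- The multiplier applied to the `j`-th dyadic block of `f`. -/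
def block : ℝ × ℝ → ℝ := fourierField f (shell j) (m.coef j) m.shift

/-- The symbols are bounded by `A` on their shells. -/
def IsBounded (A : ℝ) : Prop := ∀ ⦃j k⦄, k ∈ shell j → |m.coef j k| ≤ A

/-- The blocks of `f` under the multiplier have the size of those of a distribution of regularity
`γ`, up to the factor `D`. -/
def SupBound (γ D : ℝ) (f : PeriodicDistribution) : Prop :=
  ∀ j x, |m.block f j x| ≤ D * (4 : ℝ) ^ (-γ * j)

/-- The multiplier followed by `4 ^ (-j) ∂₁`. -/
def pdFst : Multiplier where
  coef j k := 2 * Real.pi * k.1 / 4 ^ j * m.coef j k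
  shift := m.shift + Real.pi / 2

/-- The multiplier followed by `8 ^ (-j) ∂₂`. -/
def pdSnd : Multiplier where
  coef j k := 2 * Real.pi * k.2 / 8 ^ j * m.coef j k
  shift := m.shift + Real.pi / 2

variable {m f} {A γ D : ℝ}

lemma abs_two_pi_mul_div_pow_mul_le {b n c : ℝ} (hb : 0 < b) (hn : |n| ≤ b ^ (j + 1))
    (hc : |c| ≤ A) : |2 * Real.pi * n / b ^ j * c| ≤ 2 * Real.pi * b * A := by
  have h_div : |2 * Real.pi * n / b ^ j| ≤ 2 * Real.pi * b := by
    rw [abs_div, abs_mul, abs_of_pos Real.two_pi_pos, abs_of_pos (pow_pos hb j),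
      div_le_iff₀ (pow_pos hb j), mul_assoc _ b, ← pow_succ']
    gcongr
  rw [abs_mul]
  exact mul_le_mul h_div hc (abs_nonneg _) (by positivity)

lemma IsBounded.pdFst (hm : m.IsBounded A) : m.pdFst.IsBounded (2 * Real.pi * 4 * A) :=
  fun _ _ hk => abs_two_pi_mul_div_pow_mul_le _ (by norm_num)
    (by linarith [(one_add_abs_le_of_mem_shell hk).1]) (hm hk)

lemma IsBounded.pdSnd (hm : m.IsBounded A) : m.pdSnd.IsBounded (2 * Real.pi * 8 * A) :=
  fun _ _ hk => abs_two_pi_mul_div_pow_mul_le _ (by norm_num)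
    (by linarith [(one_add_abs_le_of_mem_shell hk).2]) (hm hk)

variable (m f) in
lemma fourierField_phase_mul (v : ℝ × ℝ) :
    fourierField f (shell j) (fun k => phase k v * m.coef j k) (m.shift + Real.pi / 2) x
      = 4 ^ j * v.1 * m.pdFst.block f j x + 8 ^ j * v.2 * m.pdSnd.block f j x := by
  simp only [block, ← fourierField_const_mul]
  rw [pdFst, pdSnd, ← fourierField_add]
  congr 1
  funext k
  rw [phase]
  field_simp

variable (m γ) in
lemma monotone_supBound : Monotone (m.SupBound γ) := fun _ _ h _ hf j x =>
  (hf j x).trans (by gcongr)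

lemma blockBound (h : m.SupBound γ D f) (h_fst : m.pdFst.SupBound γ D f)
    (h_snd : m.pdSnd.SupBound γ D f) : BlockBound γ D (m.block f) := by
  refine ⟨fun j => isPeriodic_fourierField _ _ _ _, fun j => continuous_fourierField _ _ _ _, h,
    fun j x y => ?_⟩
  have h_deriv (z : ℝ × ℝ) : |fourierField f (shell j) (fun k => phase k (y - x) * m.coef j k)
      (m.shift + Real.pi / 2) z|
        ≤ D * (4 : ℝ) ^ (-γ * j) * (4 ^ j * |y.1 - x.1| + 8 ^ j * |y.2 - x.2|) := by
    rw [fourierField_phase_mul]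
    refine (abs_add_le _ _).trans ?_
    rw [abs_mul, abs_mul, abs_mul, abs_mul, abs_of_pos (by positivity : (0 : ℝ) < 4 ^ j),
      abs_of_pos (by positivity : (0 : ℝ) < 8 ^ j), Prod.fst_sub, Prod.snd_sub, mul_add,
      mul_comm (D * _), mul_comm (D * _)]
    gcongr
    exacts [h_fst j z, h_snd j z]
  simpa only [add_sub_cancel, block] using abs_fourierField_add_sub_le x h_deriv

/-- The multiplier `4 ^ (2 * j) ∂₁⁻²`, restricted to the frequencies with `4 ^ j ≤ |k₁|`. -/
def invFst : Multiplier where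
  coef j k := if 4 ^ j ≤ |k.1| then -(4 ^ j / (2 * Real.pi * k.1)) ^ 2 else 0
  shift := 0

/-- The multiplier `8 ^ j ∂₂⁻¹`, restricted to the frequencies with `|k₁| < 4 ^ j`. -/
def invSnd : Multiplier where
  coef j k := if 4 ^ j ≤ |k.1| then 0 else 8 ^ j / (2 * Real.pi * k.2)
  shift := -(Real.pi / 2)

lemma invFst_coef_neg (k : ℤ × ℤ) : invFst.coef j (-k) = invFst.coef j k := by
  simp [invFst, div_neg]

lemma invSnd_coef_neg (k : ℤ × ℤ) : invSnd.coef j (-k) = -invSnd.coef j k := by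
  simp only [invSnd, Prod.fst_neg, Prod.snd_neg, abs_neg, Int.cast_neg, mul_neg, div_neg]
  split_ifs <;> simp

variable {j} {k : ℤ × ℤ}

lemma le_abs_snd_of_mem_shell (hk : k ∈ shell j) (h : ¬4 ^ j ≤ |k.1|) : 8 ^ j ≤ |k.2| := by
  have h_box := (Finset.mem_sdiff.1 hk).2
  rw [mem_freqBox, not_and] at h_box
  exact not_lt.1 (h_box (not_le.1 h))

lemma intCast_ne_zero_of_le_abs {b n : ℤ} (hb : 0 < b) (h : b ^ j ≤ |n|) : (n : ℝ) ≠ 0 :=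
  Int.cast_ne_zero.2 (abs_pos.1 ((pow_pos hb j).trans_le h))

lemma abs_pow_div_two_pi_mul_le_one {b n : ℤ} (hb : 0 < b) (h : b ^ j ≤ |n|) :
    |(b : ℝ) ^ j / (2 * Real.pi * n)| ≤ 1 := by
  have hb' : (0 : ℝ) < b := by exact_mod_cast hb
  have hn : (b : ℝ) ^ j ≤ |(n : ℝ)| := by exact_mod_cast h
  have h_pi : 1 ≤ 2 * Real.pi := by linarith [Real.pi_gt_three]
  rw [abs_div, abs_mul, abs_of_pos Real.two_pi_pos, abs_of_pos (pow_pos hb' j)]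
  exact div_le_one_of_le₀ (hn.trans (le_mul_of_one_le_left (abs_nonneg _) h_pi)) (by positivity)

lemma isBounded_invFst : invFst.IsBounded 1 := fun j k _ => by
  simp only [invFst]
  split_ifs with h
  · rw [abs_neg, abs_pow]
    exact pow_le_one₀ (abs_nonneg _) (by exact_mod_cast abs_pow_div_two_pi_mul_le_one four_pos h)
  · simp

lemma isBounded_invSnd : invSnd.IsBounded 1 := fun j k hk => by
  simp only [invSnd]
  split_ifs with h
  · simp
  · exact_mod_cast abs_pow_div_two_pi_mul_le_one (by norm_num) (le_abs_snd_of_mem_shell hk h)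

lemma invFst_coef_add_invSnd_coef (hk : k ∈ shell j) :
    -(2 * Real.pi * k.1) ^ 2 * ((4 : ℝ) ^ (-2 * j : ℝ) * invFst.coef j k)
      + 2 * Real.pi * k.2 * ((4 : ℝ) ^ (-(3 / 2) * j : ℝ) * invSnd.coef j k) = 1 := by
  rw [neg_mul 2, neg_mul (3 / 2), Real.rpow_neg (by norm_num), Real.rpow_neg (by norm_num),
    four_rpow_two_mul, four_rpow_three_halves_mul]
  simp only [invFst, invSnd]
  split_ifs with h
  · have h1 := intCast_ne_zero_of_le_abs four_pos h
    field_simp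
    simp
  · have h2 := intCast_ne_zero_of_le_abs (by norm_num) (le_abs_snd_of_mem_shell hk h)
    field_simp
    simp

end Multiplier

section HasHolderRep

open Multiplier

variable {f : PeriodicDistribution} {β γ D : ℝ}

lemma hasSum_setIntegral_tsum_invFst (hγ : -2 < γ) (hf : BlockBound γ D (invFst.block f))
    (k : ℤ × ℤ) (ψ : ℝ) :
    HasSum (fun j => if k ∈ shell j then
        -(2 * Real.pi * k.1) ^ 2 * ((4 : ℝ) ^ (-2 * j : ℝ) * invFst.coef j k) * f.1 (trig k ψ)
        else 0)
      (∫ x in unitCell, (∑' j : ℕ, (4 : ℝ) ^ (-2 * j : ℝ) * invFst.block f j x)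
        * (pd1 (pd1 (trig k ψ))).1 x) := by
  have h_term (j : ℕ) : ∫ x in unitCell, (4 : ℝ) ^ (-2 * j : ℝ) * invFst.block f j x
      * (pd1 (pd1 (trig k ψ))).1 x = if k ∈ shell j then
        -(2 * Real.pi * k.1) ^ 2 * ((4 : ℝ) ^ (-2 * j : ℝ) * invFst.coef j k) * f.1 (trig k ψ)
        else 0 := by
    have h : ∫ x in unitCell, invFst.block f j x * (trig k ψ).1 x = _ :=
      setIntegral_fourierField_mul_trig_of_even f k ψ (neg_mem_shell j) (invFst_coef_neg j)
    calc _ = -(2 * Real.pi * k.1) ^ 2 * (4 : ℝ) ^ (-2 * j : ℝ)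
          * ∫ x in unitCell, invFst.block f j x * (trig k ψ).1 x := by
          rw [← integral_const_mul]
          congr 1 with x
          rw [pd1_pd1_trig, Submodule.coe_smul, Pi.smul_apply, smul_eq_mul]
          ring
      _ = _ := by
          rw [h]
          split_ifs <;> ring
  simpa only [h_term] using (hf.rpow_mul 2).hasSum_setIntegral_mul (by linarith)
    (pd1 (pd1 (trig k ψ)))

lemma hasSum_setIntegral_tsum_invSnd (hγ : -(3 / 2) < γ) (hf : BlockBound γ D (invSnd.block f))
    (k : ℤ × ℤ) (ψ : ℝ) :
    HasSum (fun j => if k ∈ shell j then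
        -(2 * Real.pi * k.2 * ((4 : ℝ) ^ (-(3 / 2) * j : ℝ) * invSnd.coef j k) * f.1 (trig k ψ))
        else 0)
      (∫ x in unitCell, (∑' j : ℕ, (4 : ℝ) ^ (-(3 / 2) * j : ℝ) * invSnd.block f j x)
        * (pd2 (trig k ψ)).1 x) := by
  have h_term (j : ℕ) : ∫ x in unitCell, (4 : ℝ) ^ (-(3 / 2) * j : ℝ) * invSnd.block f j x
      * (pd2 (trig k ψ)).1 x = if k ∈ shell j then
        -(2 * Real.pi * k.2 * ((4 : ℝ) ^ (-(3 / 2) * j : ℝ) * invSnd.coef j k) * f.1 (trig k ψ))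
        else 0 := by
    have h : ∫ x in unitCell, invSnd.block f j x * (trig k (ψ + Real.pi / 2)).1 x = _ :=
      setIntegral_fourierField_mul_trig_of_odd f k (ψ + Real.pi / 2) (neg_mem_shell j)
        (invSnd_coef_neg j)
    rw [add_assoc, add_halves, trig_add_pi, map_neg] at h
    calc _ = 2 * Real.pi * k.2 * (4 : ℝ) ^ (-(3 / 2) * j : ℝ)
          * ∫ x in unitCell, invSnd.block f j x * (trig k (ψ + Real.pi / 2)).1 x := by
          rw [← integral_const_mul]
          congr 1 with x
          rw [pd2_trig, Submodule.coe_smul, Pi.smul_apply, smul_eq_mul]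
          ring
      _ = _ := by
          rw [h]
          split_ifs <;> ring
  simpa only [h_term] using (hf.rpow_mul (3 / 2)).hasSum_setIntegral_mul (by linarith)
    (pd2 (trig k ψ))

theorem hasHolderRep_of_blockBound (hβ : -(3 / 2) < β) (hβ1 : β ≤ -1) (hβγ : β < γ)
    (h_zero : |f.1 (trig 0 0)| ≤ D) (h_fst : BlockBound γ D (invFst.block f))
    (h_snd : BlockBound γ D (invSnd.block f)) :
    HasHolderRep β (2 * D * (1 - (4 : ℝ) ^ (-(γ - β)))⁻¹) f := by
  have hg := (h_fst.rpow_mul 2).holderBound_tsum (α := β + 2) (by linarith) (by linarith)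
    (by linarith)
  have hh := (h_snd.rpow_mul (3 / 2)).holderBound_tsum (α := β + 3 / 2) (by linarith)
    (by linarith) (by linarith)
  rw [add_sub_add_right_eq_sub] at hg hh
  have h_const : D ≤ 2 * D * (1 - (4 : ℝ) ^ (-(γ - β)))⁻¹ := by
    have hD := (abs_nonneg _).trans h_zero
    have h_lt : (4 : ℝ) ^ (-(γ - β)) < 1 :=
      Real.rpow_lt_one_of_one_lt_of_neg (by norm_num) (by linarith)
    have h_pos : (0 : ℝ) < 4 ^ (-(γ - β)) := by positivity
    have h_inv := (one_le_inv₀ (sub_pos.2 h_lt)).2 (by linarith)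
    nlinarith
  refine ⟨f.1 (trig 0 0), _, _, h_zero.trans h_const, hg, hh, represents_of_forall_trig
    (hg.continuous (by linarith)) hg.periodic (hh.continuous (by linarith)) hh.periodic
    fun k ψ => ?_⟩
  have h_sum := (hasSum_setIntegral_tsum_invFst (by linarith) h_fst k ψ).sub
    (hasSum_setIntegral_tsum_invSnd (by linarith) h_snd k ψ)
  have h_shell (j : ℕ) :
      ((if k ∈ shell j then -(2 * Real.pi * k.1) ^ 2 *
          ((4 : ℝ) ^ (-2 * j : ℝ) * invFst.coef j k) * f.1 (trig k ψ) else 0)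
        - if k ∈ shell j then
          -(2 * Real.pi * k.2 * ((4 : ℝ) ^ (-(3 / 2) * j : ℝ) * invSnd.coef j k) * f.1 (trig k ψ))
          else 0)
        = if k ∈ shell j then f.1 (trig k ψ) else 0 := by
    split_ifs with hk
    · rw [sub_neg_eq_add, ← add_mul, invFst_coef_add_invSnd_coef hk, one_mul]
    · exact sub_zero 0
  simp only [h_shell] at h_sum
  rw [add_sub_assoc, h_sum.unique (hasSum_shell_ite k _)]
  simp only [trig_apply, setIntegral_cos_phase]
  split_ifs with hk
  · have h_sin : trig 0 (Real.pi / 2) = 0 := by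
      ext x
      simp [trig_apply, phase_zero_left]
    rw [hk, apply_trig, h_sin, map_zero]
    ring
  · ring

end HasHolderRep

/-! ### Moments of white noise -/

universe u

section GaussianMoments

variable {Ω : Type*} [MeasurableSpace Ω] {μ : Measure Ω} {ξ : Ω → PeriodicDistribution}

/-- The absolute moment of order `P` of the standard Gaussian. -/
def gaussMoment (P : ℕ) : ℝ≥0∞ :=
  ∫⁻ x, ENNReal.ofReal (|x| ^ P) ∂ProbabilityTheory.gaussianReal 0 1

lemma gaussMoment_ne_top (P : ℕ) : gaussMoment P ≠ ⊤ := by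
  have h := (ProbabilityTheory.memLp_id_gaussianReal (μ := 0) (v := 1) P).integrable_norm_pow'
  simp only [id_eq, Real.norm_eq_abs] at h
  exact h.lintegral_lt_top.ne

lemma lintegral_abs_pow_gaussianReal (v : ℝ≥0) (P : ℕ) :
    ∫⁻ x, ENNReal.ofReal (|x| ^ P) ∂ProbabilityTheory.gaussianReal 0 v
      = ENNReal.ofReal (√v ^ P) * gaussMoment P := by
  have h_map := ProbabilityTheory.gaussianReal_map_const_mul (μ := 0) (v := 1) √v
  have h_var : NNReal.mk (√v ^ 2) (sq_nonneg _) * 1 = v := by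
    rw [mul_one]
    exact NNReal.eq (Real.sq_sqrt v.2)
  rw [mul_zero, h_var] at h_map
  rw [← h_map, lintegral_map (by fun_prop) (by fun_prop), gaussMoment,
    ← lintegral_const_mul _ (by fun_prop)]
  refine lintegral_congr fun x => ?_
  rw [abs_mul, mul_pow, abs_of_nonneg (Real.sqrt_nonneg _), ENNReal.ofReal_mul (by positivity)]

lemma IsWhiteNoise.isProbabilityMeasure (hξ : IsWhiteNoise μ ξ) : IsProbabilityMeasure μ :=
  (hξ 0).isProbabilityMeasure_iff.2 inferInstance

lemma IsWhiteNoise.aemeasurable_abs_div_pow (hξ : IsWhiteNoise μ ξ) (u : TestFun) (w : ℝ) (P : ℕ) :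
    AEMeasurable (fun θ => ENNReal.ofReal ((|(ξ θ).1 u| / w) ^ P)) μ := by
  have h := (hξ u).aemeasurable
  fun_prop

lemma IsWhiteNoise.lintegral_abs_div_pow (hξ : IsWhiteNoise μ ξ) (u : TestFun) {w : ℝ} (hw : 0 ≤ w)
    (P : ℕ) : ∫⁻ θ, ENNReal.ofReal ((|(ξ θ).1 u| / w) ^ P) ∂μ
      = ENNReal.ofReal ((√(∫ x in unitCell, u.1 x ^ 2) / w) ^ P) * gaussMoment P := by
  have h_law : ∫⁻ θ, ENNReal.ofReal (|(ξ θ).1 u| ^ P) ∂μ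
      = ENNReal.ofReal (√(∫ x in unitCell, u.1 x ^ 2) ^ P) * gaussMoment P := by
    rw [← lintegral_map' (f := fun x : ℝ => ENNReal.ofReal (|x| ^ P)) (by fun_prop)
      (hξ u).aemeasurable, (hξ u).map_eq, lintegral_abs_pow_gaussianReal, Real.coe_toNNReal _
      (integral_nonneg fun _ => sq_nonneg _)]
  have h_div (t : ℝ) :
      ENNReal.ofReal ((t / w) ^ P) = ENNReal.ofReal (w ^ P)⁻¹ * ENNReal.ofReal (t ^ P) := by
    rw [← ENNReal.ofReal_mul (by positivity), div_pow, div_eq_inv_mul]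
  simp only [h_div]
  rw [lintegral_const_mul' _ _ ENNReal.ofReal_ne_top, h_law, mul_assoc]

end GaussianMoments

/-- White noise satisfies the bound `Q B` for a random constant `B` whose moment of order `p` is
at most a constant that depends only on `p` and `Q`. -/
def MomentBounded (p : ℝ) (Q : ℝ → PeriodicDistribution → Prop) : Prop :=
  ∃ K : ℝ≥0, ∀ (Ω : Type u) [MeasurableSpace Ω] (μ : Measure Ω) (ξ : Ω → PeriodicDistribution),
    IsWhiteNoise μ ξ → ∃ B : Ω → ℝ≥0∞, AEMeasurable B μ ∧ ∫⁻ θ, B θ ^ p ∂μ ≤ K ∧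
      ∀ θ, B θ ≠ ⊤ → Q (B θ).toReal (ξ θ)

namespace MomentBounded

variable {p q A : ℝ} {Q Q₁ Q₂ : ℝ → PeriodicDistribution → Prop}

lemma imp (hQ : MomentBounded.{u} p Q₁) (h : ∀ ⦃B f⦄, 0 ≤ B → Q₁ B f → Q₂ B f) :
    MomentBounded.{u} p Q₂ := by
  obtain ⟨K, hK⟩ := hQ
  refine ⟨K, fun Ω _ μ ξ hξ => ?_⟩
  obtain ⟨B, hB, hBK, hBQ⟩ := hK Ω μ ξ hξ
  exact ⟨B, hB, hBK, fun θ hθ => h ENNReal.toReal_nonneg (hBQ θ hθ)⟩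

lemma of_const_mul (hp : 0 ≤ p) (hA : 0 < A) (hQ : MomentBounded.{u} p fun B => Q (A * B)) :
    MomentBounded.{u} p Q := by
  obtain ⟨K, hK⟩ := hQ
  have hA_ne : ENNReal.ofReal A ≠ 0 := (ENNReal.ofReal_pos.2 hA).ne'
  refine ⟨(ENNReal.ofReal A ^ p).toNNReal * K, fun Ω _ μ ξ hξ => ?_⟩
  obtain ⟨B, hB, hBK, hBQ⟩ := hK Ω μ ξ hξ
  have hA_top : ENNReal.ofReal A ^ p ≠ ⊤ := ENNReal.rpow_ne_top_of_nonneg hp ENNReal.ofReal_ne_top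
  refine ⟨fun θ => ENNReal.ofReal A * B θ, hB.const_mul _, ?_, fun θ hθ => ?_⟩
  · simp only [ENNReal.mul_rpow_of_nonneg _ _ hp]
    rw [lintegral_const_mul' _ _ hA_top, ENNReal.coe_mul, ENNReal.coe_toNNReal hA_top]
    gcongr
  · rw [ENNReal.toReal_mul, ENNReal.toReal_ofReal hA.le]
    exact hBQ θ fun h => hθ (by simp only [h, ENNReal.mul_top hA_ne])

lemma and (hp : 0 ≤ p) (h₁ : MomentBounded.{u} p Q₁) (h₂ : MomentBounded.{u} p Q₂)
    (hQ₁ : Monotone Q₁) (hQ₂ : Monotone Q₂) : MomentBounded.{u} p (Q₁ ⊓ Q₂) := by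
  obtain ⟨K₁, hK₁⟩ := h₁
  obtain ⟨K₂, hK₂⟩ := h₂
  refine ⟨K₁ + K₂, fun Ω _ μ ξ hξ => ?_⟩
  obtain ⟨B₁, hB₁, hBK₁, hBQ₁⟩ := hK₁ Ω μ ξ hξ
  obtain ⟨B₂, hB₂, hBK₂, hBQ₂⟩ := hK₂ Ω μ ξ hξ
  refine ⟨fun θ => max (B₁ θ) (B₂ θ), hB₁.sup hB₂, ?_, fun θ hθ => ?_⟩
  · calc ∫⁻ θ, max (B₁ θ) (B₂ θ) ^ p ∂μ ≤ ∫⁻ θ, B₁ θ ^ p + B₂ θ ^ p ∂μ := by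
          refine lintegral_mono fun θ => ?_
          rw [(ENNReal.monotone_rpow_of_nonneg hp).map_max]
          exact max_le_add_of_nonneg zero_le zero_le
      _ ≤ ↑(K₁ + K₂) := by
          rw [lintegral_add_left' (hB₁.pow_const p), ENNReal.coe_add]
          gcongr
  · have hθ₁ := ne_top_of_le_ne_top hθ (le_max_left _ _)
    have hθ₂ := ne_top_of_le_ne_top hθ (le_max_right _ _)
    exact ⟨hQ₁ (ENNReal.toReal_mono hθ (le_max_left _ _)) _ (hBQ₁ θ hθ₁),
      hQ₂ (ENNReal.toReal_mono hθ (le_max_right _ _)) _ (hBQ₂ θ hθ₂)⟩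

lemma of_exponent_le (hp : 0 ≤ p) (hpq : p ≤ q) (hQ : MomentBounded.{u} q Q) :
    MomentBounded.{u} p Q := by
  obtain ⟨K, hK⟩ := hQ
  refine ⟨1 + K, fun Ω _ μ ξ hξ => ?_⟩
  have := hξ.isProbabilityMeasure
  obtain ⟨B, hB, hBK, hBQ⟩ := hK Ω μ ξ hξ
  have h_rpow (x : ℝ≥0∞) : x ^ p ≤ 1 + x ^ q := by
    rcases le_total x 1 with h | h
    · exact (ENNReal.rpow_le_one h hp).trans le_self_add
    · exact (ENNReal.rpow_le_rpow_of_exponent_le h hpq).trans le_add_self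
  refine ⟨B, hB, ?_, hBQ⟩
  calc ∫⁻ θ, B θ ^ p ∂μ ≤ ∫⁻ θ, 1 + B θ ^ q ∂μ := lintegral_mono fun θ => h_rpow _
    _ = 1 + ∫⁻ θ, B θ ^ q ∂μ := by
        rw [lintegral_add_left measurable_const, lintegral_one, measure_univ]
    _ ≤ ↑(1 + K) := by
        rw [ENNReal.coe_add, ENNReal.coe_one]
        gcongr

/- The union bound: the random constant is `(∑ i, (|ξ (u i)| / w i) ^ P) ^ (1 / P)`. -/
lemma of_summable {ι : Type*} [Countable ι] {t : ι → TestFun} {w : ι → ℝ} {P : ℕ} (hP : P ≠ 0)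
    (hw : ∀ i, 0 < w i)
    (h_sum : Summable fun i => (√(∫ x in unitCell, (t i).1 x ^ 2) / w i) ^ P) :
    MomentBounded.{u} P fun B f => ∀ i, |f.1 (t i)| ≤ B * w i := by
  have hP' : (P : ℝ) ≠ 0 := Nat.cast_ne_zero.2 hP
  set K := (∑' i, ENNReal.ofReal ((√(∫ x in unitCell, (t i).1 x ^ 2) / w i) ^ P)) * gaussMoment P
  have hK : K ≠ ⊤ := ENNReal.mul_ne_top h_sum.tsum_ofReal_ne_top (gaussMoment_ne_top P)
  refine ⟨K.toNNReal, fun Ω _ μ ξ hξ => ⟨fun θ =>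
    (∑' i, ENNReal.ofReal ((|(ξ θ).1 (t i)| / w i) ^ P)) ^ (P : ℝ)⁻¹,
    (AEMeasurable.tsum fun i => hξ.aemeasurable_abs_div_pow _ _ _).pow_const _, ?_,
    fun θ hθ i => ?_⟩⟩
  · simp only [ENNReal.rpow_inv_rpow hP']
    rw [lintegral_tsum fun i => hξ.aemeasurable_abs_div_pow _ _ _]
    simp only [hξ.lintegral_abs_div_pow _ (hw _).le, ENNReal.tsum_mul_right]
    exact (ENNReal.coe_toNNReal hK).ge
  · have h_nonneg : 0 ≤ |(ξ θ).1 (t i)| / w i := div_nonneg (abs_nonneg _) (hw i).le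
    rw [← div_le_iff₀ (hw i), ← ENNReal.ofReal_le_iff_le_toReal hθ,
      ← ENNReal.rpow_le_rpow_iff (z := P) (by positivity), ENNReal.rpow_inv_rpow hP',
      ENNReal.ofReal_rpow_of_nonneg h_nonneg (by positivity), Real.rpow_natCast]
    exact ENNReal.le_tsum i

end MomentBounded

section WhiteNoiseRegularity

variable {p β γ A : ℝ} {m : Multiplier}

lemma setIntegral_trig_sq_le (k : ℤ × ℤ) (φ : ℝ) : ∫ x in unitCell, (trig k φ).1 x ^ 2 ≤ 1 := by
  calc ∫ x in unitCell, (trig k φ).1 x ^ 2 ≤ ∫ _ in unitCell, (1 : ℝ) := by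
        refine integral_mono (integrableOn_unitCell ((continuous_testFun _).pow 2))
          (integrable_const _) fun x => ?_
        simp only [trig_apply]
        exact Real.cos_sq_le_one _
    _ = 1 := by simp

lemma summable_freqWeight_pow {P : ℕ} (hP : 2 ≤ P) :
    Summable fun k => (1 / freqWeight k) ^ P := by
  have h_nat : Summable fun n : ℕ => (1 / (1 + |(n : ℝ)|)) ^ P := by
    refine ((summable_nat_add_iff 1).2 (Real.summable_one_div_nat_pow.2 hP)).congr fun n => ?_
    rw [Nat.abs_cast, div_pow, one_pow, Nat.cast_add_one, add_comm]
  have h_int : Summable fun n : ℤ => (1 / (1 + |(n : ℝ)|)) ^ P :=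
    .of_nat_of_neg (by simpa using h_nat) (by simpa using h_nat)
  refine (h_int.mul_of_nonneg h_int (fun _ => by positivity) fun _ => by positivity).congr
    fun k => ?_
  rw [freqWeight, ← mul_pow, div_mul_div_comm, one_mul]

lemma monotone_coefBound : Monotone CoefBound := fun _ _ h _ hf k φ =>
  (hf k φ).trans (mul_le_mul_of_nonneg_right h (freqWeight_pos k).le)

lemma momentBounded_coefBound (hp : 0 ≤ p) : MomentBounded.{u} p CoefBound := by
  obtain ⟨P, hP⟩ := exists_nat_ge (max p 2)
  have hP2 : 2 ≤ P := by exact_mod_cast (le_max_right _ _).trans hP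
  have h_trig (φ : ℝ) :
      MomentBounded.{u} P fun B f => ∀ k, |f.1 (trig k φ)| ≤ B * freqWeight k := by
    refine .of_summable (by omega) freqWeight_pos (.of_nonneg_of_le (fun k => ?_) (fun k => ?_)
      (summable_freqWeight_pow hP2)) <;> have := freqWeight_pos k
    · positivity
    · gcongr
      exact Real.sqrt_le_one.2 (setIntegral_trig_sq_le k φ)
  have h_mono (φ : ℝ) : Monotone fun (B : ℝ) (f : PeriodicDistribution) =>
      ∀ k, |f.1 (trig k φ)| ≤ B * freqWeight k := fun _ _ h _ hf k =>
    (hf k).trans (mul_le_mul_of_nonneg_right h (freqWeight_pos k).le)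
  have h_and := (h_trig 0).and (by positivity) (h_trig (Real.pi / 2)) (h_mono _) (h_mono _)
  refine .of_exponent_le hp ((le_max_left _ _).trans hP)
    (.of_const_mul (by positivity) two_pos (h_and.imp ?_))
  rintro B f - ⟨hf, hf'⟩ k φ
  linarith [abs_apply_trig_le f k φ, hf k, hf' k]

lemma sqrt_setIntegral_sq_fourierKernel_shell_le {a : ℤ × ℤ → ℝ} {j : ℕ} (hA : 0 ≤ A)
    (ha : ∀ k ∈ shell j, |a k| ≤ A) (φ : ℝ) (x : ℝ × ℝ) :
    √(∫ y in unitCell, (fourierKernel (shell j) a φ x).1 y ^ 2)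
      ≤ 12 * A * (4 : ℝ) ^ (5 / 4 * j : ℝ) := by
  have h_four : ((4 : ℝ) ^ (5 / 4 * j : ℝ)) ^ 2 = 32 ^ j := by
    rw [Real.rpow_mul_natCast (by norm_num), pow_right_comm, ← Real.rpow_mul_natCast (by norm_num),
      show (4 : ℝ) = 2 ^ (2 : ℝ) by norm_num, ← Real.rpow_mul (by norm_num)]
    norm_num
  refine Real.sqrt_le_iff.2 ⟨by positivity, ?_⟩
  calc ∫ y in unitCell, (fourierKernel (shell j) a φ x).1 y ^ 2
      ≤ ∑ k ∈ shell j, a k ^ 2 := setIntegral_sq_fourierKernel_le _ _ _ _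
    _ ≤ (shell j).card * A ^ 2 := by
        rw [← nsmul_eq_mul]
        exact Finset.sum_le_card_nsmul _ _ _ fun k hk => sq_le_sq' (neg_le_of_abs_le (ha k hk))
          (le_of_abs_le (ha k hk))
    _ ≤ 4 * 32 ^ (j + 1) * A ^ 2 := by
        gcongr
        exact_mod_cast card_shell_le j
    _ ≤ (12 * A * (4 : ℝ) ^ (5 / 4 * j : ℝ)) ^ 2 := by
        rw [mul_pow _ ((4 : ℝ) ^ _), h_four, pow_succ]
        nlinarith [mul_nonneg (sq_nonneg A) (pow_nonneg (by norm_num : (0 : ℝ) ≤ 32) j)]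

lemma summable_gridSize_sq_mul {c : ℝ} {P : ℕ} (hP : 13 < (-(5 / 4) - γ) * P) :
    Summable fun j => (gridSize j : ℝ) ^ 2
      * (c * (4 : ℝ) ^ (5 / 4 * j : ℝ) / (4 : ℝ) ^ (-γ * j)) ^ P := by
  refine ((hasSum_four_rpow (sub_pos.2 hP)).summable.mul_left (4 ^ 13 * c ^ P)).congr fun j => ?_
  have h_size : (gridSize j : ℝ) ^ 2 = 4 ^ 13 * (4 : ℝ) ^ (13 * j : ℝ) := by
    rw [Real.rpow_mul_natCast (by norm_num), gridSize, Nat.cast_pow, pow_right_comm, pow_succ']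
    norm_num
  rw [h_size, mul_div_assoc, ← Real.rpow_sub (by norm_num), mul_pow,
    ← Real.rpow_mul_natCast (by norm_num), mul_mul_mul_comm, ← Real.rpow_add (by norm_num)]
  ring_nf

namespace Multiplier

lemma momentBounded_gridPoint (hm : m.IsBounded A) (hA : 0 ≤ A) {P : ℕ}
    (hP : 13 < (-(5 / 4) - γ) * P) :
    MomentBounded.{u} P fun B f => ∀ j (q : Fin (gridSize j) × Fin (gridSize j)),
      |m.block f j (gridPoint q)| ≤ B * (4 : ℝ) ^ (-γ * j) := by
  have hP0 : P ≠ 0 := by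
    rintro rfl
    norm_num at hP
  have h_std (i : Σ j, Fin (gridSize j) × Fin (gridSize j)) :
      (√(∫ x in unitCell,
          (fourierKernel (shell i.1) (m.coef i.1) m.shift (gridPoint i.2)).1 x ^ 2)
            / (4 : ℝ) ^ (-γ * i.1)) ^ P
        ≤ (12 * A * (4 : ℝ) ^ (5 / 4 * i.1 : ℝ) / (4 : ℝ) ^ (-γ * i.1)) ^ P := by
    gcongr
    exact sqrt_setIntegral_sq_fourierKernel_shell_le hA (fun _ hk => hm hk) _ _
  have h_sum := (summable_sigma_of_nonneg
    (f := fun i : Σ j, Fin (gridSize j) × Fin (gridSize j) =>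
      (12 * A * (4 : ℝ) ^ (5 / 4 * i.1 : ℝ) / (4 : ℝ) ^ (-γ * i.1)) ^ P)
    fun _ => by positivity).2 ⟨fun _ => .of_finite, by
      simpa [← sq] using summable_gridSize_sq_mul (c := 12 * A) hP⟩
  exact (MomentBounded.of_summable hP0 (fun _ => by positivity)
    (h_sum.of_nonneg_of_le (fun _ => by positivity) h_std)).imp
      fun B f _ hB j q => hB ⟨j, q⟩

lemma momentBounded_supBound (hp : 0 ≤ p) (hm : m.IsBounded A) (hA : 0 ≤ A) (hγ : γ < -(5 / 4)) :
    MomentBounded.{u} p (m.SupBound γ) := by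
  obtain ⟨P, hP⟩ := exists_nat_gt (max p (13 / (-(5 / 4) - γ)))
  have hpP : p ≤ P := ((le_max_left _ _).trans_lt hP).le
  have h_grid := momentBounded_gridPoint.{u} (γ := γ) hm hA
    ((div_lt_iff₀' (by linarith)).1 ((le_max_right _ _).trans_lt hP))
  have h_mono : Monotone fun (B : ℝ) (f : PeriodicDistribution) =>
      ∀ j (q : Fin (gridSize j) × Fin (gridSize j)),
        |m.block f j (gridPoint q)| ≤ B * (4 : ℝ) ^ (-γ * j) := fun _ _ h _ hf j q =>
    (hf j q).trans (by gcongr)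
  refine .of_const_mul hp (by positivity : 0 < 1 + 16 * Real.pi * A)
    (((h_grid.of_exponent_le hp hpP).and hp (momentBounded_coefBound hp) h_mono
      monotone_coefBound).imp ?_)
  rintro B f hB ⟨hf, hf_coef⟩ j x
  have h_one : (1 : ℝ) ≤ 4 ^ (-γ * j) :=
    Real.one_le_rpow (by norm_num) (mul_nonneg (by linarith) j.cast_nonneg)
  calc |m.block f j x|
      ≤ B * (4 : ℝ) ^ (-γ * j) + 16 * Real.pi * (A * B) * 1 := by
        rw [mul_one]
        exact hf_coef.abs_fourierField_le_of_gridPoint hA (fun _ hk => hm hk) _ (hf j) x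
    _ ≤ B * (4 : ℝ) ^ (-γ * j) + 16 * Real.pi * (A * B) * (4 : ℝ) ^ (-γ * j) := by gcongr
    _ = (1 + 16 * Real.pi * A) * B * (4 : ℝ) ^ (-γ * j) := by ring

lemma momentBounded_blockBound (hp : 0 ≤ p) (hm : m.IsBounded A) (hA : 0 ≤ A)
    (hγ : γ < -(5 / 4)) : MomentBounded.{u} p fun B f => BlockBound γ B (m.block f) := by
  have h_fst := momentBounded_supBound.{u} hp hm.pdFst (by positivity) hγ
  have h_snd := momentBounded_supBound.{u} hp hm.pdSnd (by positivity) hγ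
  have h_derivs := h_fst.and hp h_snd (monotone_supBound _ _) (monotone_supBound _ _)
  refine ((momentBounded_supBound hp hm hA hγ).and hp h_derivs (monotone_supBound _ _)
    ((monotone_supBound _ _).inf (monotone_supBound _ _))).imp ?_
  rintro B f - ⟨hf, hf_fst, hf_snd⟩
  exact blockBound hf hf_fst hf_snd

end Multiplier

theorem momentBounded_hasHolderRep (hp : 0 ≤ p) (hβ : -(3 / 2) < β) (hβ' : β < -(5 / 4)) :
    MomentBounded.{u} p (HasHolderRep β) := by
  obtain ⟨γ, hβγ, hγ⟩ := exists_between hβ'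
  have h_mono (m : Multiplier) : Monotone fun (B : ℝ) f => BlockBound γ B (m.block f) :=
    fun _ _ h _ hf => hf.mono h
  have h_blocks := (Multiplier.momentBounded_blockBound.{u} hp Multiplier.isBounded_invFst
    zero_le_one hγ).and hp (Multiplier.momentBounded_blockBound hp Multiplier.isBounded_invSnd
    zero_le_one hγ) (h_mono _) (h_mono _)
  have h_lt : (4 : ℝ) ^ (-(γ - β)) < 1 :=
    Real.rpow_lt_one_of_one_lt_of_neg (by norm_num) (by linarith)
  have h_const : 0 < 2 * (1 - (4 : ℝ) ^ (-(γ - β)))⁻¹ :=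
    mul_pos two_pos (inv_pos.2 (sub_pos.2 h_lt))
  refine .of_const_mul hp h_const ((h_blocks.and hp (momentBounded_coefBound hp)
    ((h_mono _).inf (h_mono _)) monotone_coefBound).imp ?_)
  rintro B f - ⟨⟨hf_fst, hf_snd⟩, hf⟩
  have h_zero : |f.1 (trig 0 0)| ≤ B := by simpa [freqWeight] using hf 0 0
  rw [mul_right_comm]
  exact hasHolderRep_of_blockBound hβ (by linarith) hβγ h_zero hf_fst hf_snd

end WhiteNoiseRegularity

/-! ### Expectations -/

section Expectation

variable {Ω : Type*} [MeasurableSpace Ω] {μ : Measure Ω} {p : ℝ}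

lemma expect_mono {F G : Ω → ℝ≥0∞} (h : ∀ θ, F θ ≤ G θ) : expect μ F ≤ expect μ G :=
  iInf_mono fun _ => iInf_mono fun _ =>
    iInf_mono' fun hG => ⟨hG.mono fun θ hθ => (h θ).trans hθ, le_rfl⟩

lemma expect_le_lintegral {F M : Ω → ℝ≥0∞} (hM : AEMeasurable M μ) (h : F ≤ᵐ[μ] M) :
    expect μ F ≤ ∫⁻ θ, M θ ∂μ := by
  rw [lintegral_congr_ae hM.ae_eq_mk]
  exact iInf_le_of_le (hM.mk M) (iInf_le_of_le hM.measurable_mk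
    (iInf_le_of_le (h.trans hM.ae_eq_mk.le) le_rfl))

lemma MomentBounded.exists_expect_le {Q : ℝ → PeriodicDistribution → Prop} (hp : 0 < p)
    (hQ : MomentBounded.{u} p Q) : ∃ K : ℝ≥0, ∀ (Ω : Type u) [MeasurableSpace Ω] (μ : Measure Ω)
      (ξ : Ω → PeriodicDistribution), IsWhiteNoise μ ξ → ∀ (A : ℝ)
      (F : PeriodicDistribution → ℝ≥0∞), (∀ B f, Q B f → F f ≤ ENNReal.ofReal (A * B) ^ p) →
        expect μ (fun θ => F (ξ θ)) ≤ ENNReal.ofReal A ^ p * K := by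
  obtain ⟨K, hK⟩ := hQ
  refine ⟨K, fun Ω _ μ ξ hξ A F hF => ?_⟩
  obtain ⟨B, hB, hBK, hBQ⟩ := hK Ω μ ξ hξ
  have h_top : ∀ᵐ θ ∂μ, B θ ^ p < ⊤ :=
    ae_lt_top' (hB.pow_const p) (hBK.trans_lt ENNReal.coe_lt_top).ne
  have h_le : (fun θ => F (ξ θ)) ≤ᵐ[μ] fun θ => ENNReal.ofReal A ^ p * B θ ^ p := by
    filter_upwards [h_top] with θ hθ
    have hθ' : B θ ≠ ⊤ := ((ENNReal.rpow_lt_top_iff_of_pos hp).1 hθ).ne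
    refine (hF _ _ (hBQ θ hθ')).trans_eq ?_
    rw [ENNReal.ofReal_mul' ENNReal.toReal_nonneg, ENNReal.ofReal_toReal hθ',
      ENNReal.mul_rpow_of_nonneg _ _ hp.le]
  refine (expect_le_lintegral ((hB.pow_const p).const_mul _) h_le).trans ?_
  rw [lintegral_const_mul' _ _ (ENNReal.rpow_ne_top_of_nonneg hp.le ENNReal.ofReal_ne_top)]
  gcongr

end Expectation

variable {p ε : ℝ} (φ : 𝓢(ℝ × ℝ, ℝ))

theorem exists_expect_iSup_holderNeg_proj_mollify_le (hp : 0 < p) (hε : 0 < ε) (hε' : ε < 1 / 4) :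
    ∃ C : ℝ≥0, ∀ (Ω : Type u) [MeasurableSpace Ω] (μ : Measure Ω) (ξ : Ω → PeriodicDistribution),
      IsWhiteNoise μ ξ →
      expect μ (fun θ => ⨆ (ℓ : ℝ) (hℓ : 0 < ℓ),
        holderNeg (-(5 / 4) - ε) (proj (mollify φ ℓ hℓ (ξ θ))) ^ p) ≤ C := by
  obtain ⟨K, hK⟩ := (momentBounded_hasHolderRep.{u} (β := -(5 / 4) - ε) hp.le (by linarith)
    (by linarith)).exists_expect_le hp
  set A := 3 * (2 * ∫ x, |φ x|) with hA
  refine ⟨(ENNReal.ofReal A ^ p).toNNReal * K, fun Ω _ μ ξ hξ => ?_⟩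
  rw [ENNReal.coe_mul, ENNReal.coe_toNNReal
    (ENNReal.rpow_ne_top_of_nonneg hp.le ENNReal.ofReal_ne_top)]
  refine hK Ω μ ξ hξ A (fun f => ⨆ (ℓ : ℝ) (hℓ : 0 < ℓ),
    holderNeg (-(5 / 4) - ε) (proj (mollify φ ℓ hℓ f)) ^ p) fun B f hf =>
      iSup₂_le fun ℓ hℓ => ENNReal.rpow_le_rpow ?_ hp.le
  refine ((hf.proj_mollify (by linarith) φ hℓ).holderNeg_le (by linarith)).trans_eq ?_
  rw [hA, ← mul_assoc 2, ← mul_assoc 3]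

theorem exists_expect_iSup_holderNeg_mollify_sub_le (hφ : ∫ x, φ x = 1) (hp : 0 < p) (hε : 0 < ε)
    (hε' : ε < 1 / 4) :
    ∃ C : ℝ≥0, ∀ (Ω : Type u) [MeasurableSpace Ω] (μ : Measure Ω) (ξ : Ω → PeriodicDistribution),
      IsWhiteNoise μ ξ → ∀ ℓ₀ : ℝ, 0 < ℓ₀ →
      expect μ (fun θ => ⨆ (ℓ : ℝ) (hℓ : 0 < ℓ) (_ : ℓ ≤ ℓ₀),
          holderNeg (-(5 / 4) - ε) (mollify φ ℓ hℓ (ξ θ) - ξ θ) ^ p) ^ (1 / p)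
        ≤ C * ENNReal.ofReal (ℓ₀ ^ (ε / 2)) := by
  set β := -(5 / 4) - ε with hβ_eq
  have hβ : -(3 / 2) < β := by linarith
  obtain ⟨K, hK⟩ := (momentBounded_hasHolderRep.{u} (β := β + ε / 2) hp.le (by linarith)
    (by linarith)).exists_expect_le hp
  have hM := mollifyConst_nonneg φ (β + ε / 2)
  set M := mollifyConst φ (β + ε / 2)
  refine ⟨(3 * M).toNNReal * K ^ (1 / p), fun Ω _ μ ξ hξ ℓ₀ _ => ?_⟩
  have h_expect := hK Ω μ ξ hξ (3 * M * ℓ₀ ^ (ε / 2)) (fun f => ⨆ (ℓ : ℝ) (hℓ : 0 < ℓ)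
    (_ : ℓ ≤ ℓ₀), holderNeg β (mollify φ ℓ hℓ f - f) ^ p) fun B f hf =>
      iSup₂_le fun ℓ hℓ => iSup_le fun hℓℓ₀ => ENNReal.rpow_le_rpow ?_ hp.le
  · calc _ ≤ (ENNReal.ofReal (3 * M * ℓ₀ ^ (ε / 2)) ^ p * K) ^ (1 / p) := by gcongr
      _ = ENNReal.ofReal (3 * M * ℓ₀ ^ (ε / 2)) * K ^ (1 / p) := by
          rw [ENNReal.mul_rpow_of_nonneg _ _ (by positivity), one_div, ENNReal.rpow_rpow_inv hp.ne']
      _ = _ := by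
          rw [ENNReal.ofReal_mul (by positivity), ENNReal.coe_mul,
            ENNReal.coe_rpow_of_nonneg _ (by positivity), mul_right_comm]
          rfl
  · have hB := hf.nonneg
    refine ((hf.mollify_sub hβ (by positivity) hφ hℓ).holderNeg_le (by linarith)).trans
      (ENNReal.ofReal_le_ofReal ?_)
    rw [← mul_assoc 3, ← mul_assoc 3]
    gcongr

theorem lemma1_general (hφ_int : ∫ x, φ x = 1) (hp : 0 < p) (hε_pos : 0 < ε) (hε_lt : ε < 1 / 4) :
    ∃ C : ℝ≥0, ∀ (Ω : Type*) [MeasurableSpace Ω] (μ : Measure Ω) (ξ : Ω → PeriodicDistribution),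
      IsWhiteNoise μ ξ →
      expect μ (fun θ => ⨆ (ℓ : ℝ) (hℓ : 0 < ℓ),
          holderNeg (-(5 / 4) - ε) (proj (mollify φ ℓ hℓ (ξ θ))) ^ p) ≤ C ∧
      ∀ ℓ₀ : ℝ, 0 < ℓ₀ →
        expect μ (fun θ => ⨆ (ℓ : ℝ) (hℓ : 0 < ℓ) (_ : ℓ ≤ ℓ₀),
            holderNeg (-(5 / 4) - ε) (mollify φ ℓ hℓ (ξ θ) - ξ θ) ^ p) ^ (1 / p)
          ≤ C * ENNReal.ofReal (ℓ₀ ^ (ε / 2)) := by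
  obtain ⟨C₁, hC₁⟩ := exists_expect_iSup_holderNeg_proj_mollify_le φ hp hε_pos hε_lt
  obtain ⟨C₂, hC₂⟩ := exists_expect_iSup_holderNeg_mollify_sub_le φ hφ_int hp hε_pos hε_lt
  refine ⟨max C₁ C₂, fun Ω _ μ ξ hξ => ⟨(hC₁ Ω μ ξ hξ).trans ?_, fun ℓ₀ hℓ₀ =>
    (hC₂ Ω μ ξ hξ ℓ₀ hℓ₀).trans ?_⟩⟩
  · exact_mod_cast le_max_left C₁ C₂
  · gcongr
    exact le_max_right C₁ C₂

end WhiteNoiseTorus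

end

open WhiteNoiseTorus in
theorem lemma1 (φ : 𝓢(ℝ × ℝ, ℝ)) (hφ_symm : ∀ x, φ (-x) = φ x) (hφ_int : ∫ x, φ x = 1)
    (p : ℝ) (hp : 1 ≤ p) (ε : ℝ) (hε_pos : 0 < ε) (hε_lt : ε < 1 / 4) :
    ∃ C : ℝ≥0, ∀ (Ω : Type*) [MeasurableSpace Ω] (μ : Measure Ω) [IsProbabilityMeasure μ]
      (ξ : Ω → PeriodicDistribution), IsWhiteNoise μ ξ →
      expect μ (fun θ => ⨆ (ℓ : ℝ) (hℓ : 0 < ℓ) (_ : ℓ ≤ 1),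
          holderNeg (-(5 / 4) - ε) (proj (mollify φ ℓ hℓ (ξ θ))) ^ p) ≤ C ∧
      ∀ ℓ₀ : ℝ, 0 < ℓ₀ → ℓ₀ ≤ 1 →
        expect μ (fun θ => ⨆ (ℓ : ℝ) (hℓ : 0 < ℓ) (_ : ℓ ≤ ℓ₀),
            holderNeg (-(5 / 4) - ε) (mollify φ ℓ hℓ (ξ θ) - ξ θ) ^ p) ^ (1 / p)
          ≤ C * ENNReal.ofReal (ℓ₀ ^ (ε / 2)) := by
  obtain ⟨C, hC⟩ := lemma1_general φ hφ_int (one_pos.trans_le hp) hε_pos hε_lt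
  exact ⟨C, fun Ω _ μ _ ξ hξ => ⟨(expect_mono fun θ => iSup₂_mono fun ℓ hℓ => iSup_const_le).trans
    (hC Ω μ ξ hξ).1, fun ℓ₀ hℓ₀ _ => (hC Ω μ ξ hξ).2 ℓ₀ hℓ₀⟩⟩
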